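/- **Setting.** Let $\mathcal G$ be a two-player zero-sum episodic Markov game with finite state set of size $S$, finite action sets $\mathcal A_{\max},\mathcal A_{\min}$ with $A=|\mathcal A_{\max}|\cdot|\mathcal A_{\min}|$, horizon $H\ge 1$, fixed initial state $s_1$, unknown transitions $\mathbb P_h(\cdot\mid s,a)$ and known rewards $r_h(s,a)\in[0,1]$, $h\in[H]$ (here $a$ is an action pair). A general policy chooses, at each step, a distribution over the player's own actions depending on the whole trajectory $\tau_h=(s_1,a_1,\dots,s_{h-1},a_{h-1},s_h)$ of the current episode. $V_1^{\mu\times\nu}(s_1)$ is the expected total reward when the max-player (learner) follows $\mu$ and the min-player (opponent) follows $\nu$. For $K\ge1$ episodes, the learner draws $\mu^k$ and the opponent chooses $\nu^k$, both general policies, independently of each other given the past; the episode is played, and its trajectory and $\nu^k$ are then revealed to the learner. The opponent may be randomized and adaptive ($\nu^k$ may depend in any way on all policies and trajectories of the previous episodes), but always $\nu^k\in\Psi^\star$, where $\Psi^\star$ is a finite set of general policies that the learner does not know. The regret after $k$ episodes is $$\mathrm{Regret}(k)=\max_{\mu}\sum_{t=1}^{k}\bigl(V_1^{\mu\times\nu^t}-V_1^{\mu^t\times\nu^t}\bigr)(s_1),$$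 the maximum being over all general policies of the max-player. **Algorithm (adaptive OP-EXP3).** Let $\delta\in(0,1)$, $\iota=\log(KHSA/\delta)$, $\beta(t)=cH\sqrt{S\iota/\max\{t,1\}}$ and $\varepsilon=1/K$. Given counters $N_h(s,a,s')$, with $N_h(s,a)=\sum_{s'}N_h(s,a,s')$, let $\widehat{\mathbb P}_h(s'\mid s,a)=N_h(s,a,s')/N_h(s,a)$, or $1/S$ if $N_h(s,a)=0$, and define the optimistic value $\overline V_1^{N,\mu\times\nu}(s_1)$ by $\overline V_{H+1}\equiv0$ and $$\overline V_h(\tau_h)=\mathbb E_{a\sim(\mu\times\nu)(\cdot\mid\tau_h)}\min\Bigl\{\mathbb E_{s'\sim\widehat{\mathbb P}_h(\cdot\mid s_h,a)}\overline V_{h+1}([\tau_h,a,s'])+r_h(s_h,a)+\beta(N_h(s_h,a)),\;H-h+1\Bigr\}.$$ For a finite set $\Psi$ of opponent policies, $\text{UCB-BestResponse}(N,\Psi)$ is the set that consists, for each point $w$ of a finite $\varepsilon$-cover in $\ell^1$ of the probability simplex over $\Psi$ (the grid of all $w$ whose coordinates are multiples of $1/\lceil|\Psi|/\varepsilon\rceil$;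 for $\Psi=\emptyset$ there is just the empty weight vector), of one general policy $\mu$ that maximizes $\sum_{\nu\in\Psi}w_\nu\overline V_1^{N,\mu\times\nu}(s_1)$. The algorithm keeps the visitation counters $N$, the lazy counters $N^{\rm lazy}$, the set $\Psi$ of opponent policies seen so far and a set $\Phi$ of player policies; initially $N=N^{\rm lazy}=0$, $\Psi=\emptyset$, $\Phi=\text{UCB-BestResponse}(0,\emptyset)$. In the $t$-th episode since the last restart (or since the start) it draws $\mu^k$ from the distribution on $\Phi$ proportional to $\exp(\eta_t G(\mu))$, where $\eta_t=\sqrt{\log|\Phi|/(tH^2)}$ and $G(\mu)$ is the sum of $\overline V_1^{N^{\rm lazy},\mu\times\nu^{j}}(s_1)$ over the previous $t-1$ episodes $j$ since the last restart. After the episode $N$ is updated. If $\nu^k\notin\Psi$, or $N_h(s,a)\ge\max\{1,2N_h^{\rm lazy}(s,a)\}$ for some $(h,s,a)$, then $\nu^k$ is added to $\Psi$, $N^{\rm lazy}$ is set to $N$, $\Phi$ to $\text{UCB-BestResponse}(N,\Psi)$, and EXP3 is restarted ($t=1$, $G=0$). **Theorem.** There is an absolute constant $c_0>0$ such that for every $c\ge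 c_0$ there is a constant $C>0$ depending only on $c$ with the following property. For every such game, every $K\ge1$, $\delta\in(0,1)$, every finite $\Psi^\star$ and every opponent as above, adaptive OP-EXP3 satisfies, with probability at least $1-\delta$, simultaneously for all $k\in\{1,\dots,K\}$, $$\mathrm{Regret}(k)\le C\Bigl(\sqrt{H^4S^2A\,k\,\iota^2}+\sqrt{|\Psi^\star|\,SAH^3\,k\,\iota^2}+\sqrt{|\Psi^\star|^2H^2\,k\,\iota}\Bigr).$$ -/

import Mathlib

/-!
Two-player zero-sum episodic Markov games, the revealed-policy protocol against an adaptive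
opponent, and the algorithm "adaptive OP-EXP3".

Conventions: the steps `1, …, H` are indexed by `Fin H` (so the step with index `h` has `h` earlier
state-action pairs and `H - h` steps to go, itself included); `A` and `B` are the action sets of the
max-player (the learner) and of the min-player (the opponent).
-/

open scoped Classical

noncomputable section

/-- A tabular episodic zero-sum Markov game with a fixed initial state. -/
structure MarkovGame (S A B : Type*) (H : ℕ) where
  /-- the initial state `s₁` -/
  start : S
  /-- the transition probabilities -/
  trans : Fin H → S → A × B → PMF S
  /-- the reward: gain of the max-player, loss of the min-player -/
  reward : Fin H → S → A × B → ℝ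
  reward_mem : ∀ h s a, reward h s a ∈ Set.Icc (0 : ℝ) 1

/-- The first `h` state-action pairs of an episode. -/
abbrev PastPairs (S A B : Type*) (h : ℕ) : Type _ := Fin h → S × (A × B)

/-- A trajectory `(s₁, a₁, …, s_h, a_h, s_{h+1})`. -/
abbrev Traj (S A B : Type*) (h : ℕ) : Type _ := PastPairs S A B h × S

/-- A general (history-dependent) policy of a player whose action set is `X`. -/
abbrev GeneralPolicy (S A B X : Type*) (H : ℕ) : Type _ :=
  (h : Fin H) → PastPairs S A B h → S → PMF X

/-- General policies of the max-player. -/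
abbrev MaxPolicy (S A B : Type*) (H : ℕ) : Type _ := GeneralPolicy S A B A H

/-- General policies of the min-player. -/
abbrev MinPolicy (S A B : Type*) (H : ℕ) : Type _ := GeneralPolicy S A B B H

section Game

variable {S A B : Type*} {H : ℕ}

/-- Append a state-action pair to the past. -/
def PastPairs.extend {h : ℕ} (τ : PastPairs S A B h) (s : S) (a : A × B) :
    PastPairs S A B (h + 1) :=
  Fin.snoc (α := fun _ => S × (A × B)) τ (s, a)

/-- The law of the trajectory up to the `(h+1)`-st state when the players follow `μ` and `ν`:
both pick their actions simultaneously (independently given the past). -/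
def MarkovGame.trajLaw (G : MarkovGame S A B H) (μ : MaxPolicy S A B H) (ν : MinPolicy S A B H) :
    (h : ℕ) → h ≤ H → PMF (Traj S A B h)
  | 0, _ => PMF.pure (Fin.elim0, G.start)
  | h + 1, hh =>
      (G.trajLaw μ ν h (Nat.le_of_succ_le hh)).bind fun x =>
        (μ ⟨h, hh⟩ x.1 x.2).bind fun a =>
          (ν ⟨h, hh⟩ x.1 x.2).bind fun b =>
            (G.trans ⟨h, hh⟩ x.2 (a, b)).map fun s' => (x.1.extend x.2 (a, b), s')

variable [Fintype S] [Fintype A] [Fintype B]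

/-- The value `V₁^{μ×ν}(s₁)`: the expected cumulative reward of the max-player. -/
def MarkovGame.value (G : MarkovGame S A B H) (μ : MaxPolicy S A B H) (ν : MinPolicy S A B H) :
    ℝ :=
  ∑ x : Traj S A B H,
    (G.trajLaw μ ν H le_rfl x).toReal * ∑ h : Fin H, G.reward h (x.1 h).1 (x.1 h).2

/-- What is known after an episode in the revealed-policy setting: the policy `pol` deployed by the
learner, the policy `opp` deployed by the opponent, and the realized trajectory. -/
structure Episode (S A B : Type*) (H : ℕ) where
  pol : MaxPolicy S A B H
  opp : MinPolicy S A B H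
  traj : Traj S A B H

/-- The regret, after the given episodes, against the best fixed general policy in hindsight.
(All values lie in `[0, H]`, so the supremum is that of a bounded set.) -/
def MarkovGame.regret (G : MarkovGame S A B H) (l : List (Episode S A B H)) : ℝ :=
  ⨆ μ : MaxPolicy S A B H, (l.map fun e => G.value μ e.opp - G.value e.pol e.opp).sum

/-- Visitation counters `N_h(s, a, s')`. -/
abbrev Counters (S A B : Type*) (H : ℕ) : Type _ := Fin H → S → A × B → S → ℕ

/-- `N_h(s, a) = ∑_{s'} N_h(s, a, s')`. -/
def Counters.visits (N : Counters S A B H) (h : Fin H) (s : S) (a : A × B) : ℕ :=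
  ∑ s' : S, N h s a s'

/-- The state `s_{h+1}` that follows the step with index `h` in a full trajectory. -/
def nextState (x : Traj S A B H) (h : Fin H) : S :=
  if hh : (h : ℕ) + 1 < H then (x.1 ⟨h + 1, hh⟩).1 else x.2

/-- The counters after one more episode with trajectory `x`. -/
def Counters.record (N : Counters S A B H) (x : Traj S A B H) : Counters S A B H :=
  fun h s a s' => N h s a s' + if x.1 h = (s, a) ∧ nextState x h = s' then 1 else 0

/-- The empirical transition probabilities (uniform where there is no data). -/
def Counters.empirical (N : Counters S A B H) (h : Fin H) (s : S) (a : A × B) (s' : S) : ℝ :=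
  if N.visits h s a ≠ 0 then (N h s a s' : ℝ) / N.visits h s a else 1 / Fintype.card S

/-- Optimistic policy evaluation of `μ × ν`, with known reward `r` and bonus function `β`:
`optValueAux r β N μ ν n h _ τ s` is the optimistic value at the step with index `h`, when `n` steps
remain, after the past `τ` and in the state `s`. -/
def optValueAux (r : Fin H → S → A × B → ℝ) (β : ℕ → ℝ) (N : Counters S A B H)
    (μ : MaxPolicy S A B H) (ν : MinPolicy S A B H) :
    (n h : ℕ) → h + n = H → PastPairs S A B h → S → ℝ
  | 0, _, _, _, _ => 0
  | n + 1, h, hh, τ, s =>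
      let k : Fin H := ⟨h, by omega⟩
      ∑ a : A, ∑ b : B, (μ k τ s a).toReal * (ν k τ s b).toReal *
        min ((∑ s' : S, N.empirical k s (a, b) s' *
                optValueAux r β N μ ν n (h + 1) (by omega) (τ.extend s (a, b)) s')
              + r k s (a, b) + β (N.visits k s (a, b)))
          ((n : ℝ) + 1)

/-- `UCB-VI(N, β, μ × ν)`: the optimistic value at the initial state. -/
def optValue (s₁ : S) (r : Fin H → S → A × B → ℝ) (β : ℕ → ℝ) (N : Counters S A B H)
    (μ : MaxPolicy S A B H) (ν : MinPolicy S A B H) : ℝ :=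
  optValueAux r β N μ ν H 0 (Nat.zero_add H) Fin.elim0 s₁

/-- The optimistic value of `μ` against the mixture that draws one policy `ν ∈ Ψ` with probability
`w ν` at the beginning of the episode. -/
def optMixValue (s₁ : S) (r : Fin H → S → A × B → ℝ) (β : ℕ → ℝ) (N : Counters S A B H)
    (Ψ : Finset (MinPolicy S A B H)) (w : MinPolicy S A B H → ℝ) (μ : MaxPolicy S A B H) : ℝ :=
  ∑ ν ∈ Ψ, w ν * optValue s₁ r β N μ ν

/-- A point of the simplex as a `PMF`. -/
def simplexPMF {X : Type*} [Fintype X] (x : stdSimplex ℝ X) : PMF X :=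
  PMF.ofFintype (fun i => ENNReal.ofReal (x.1 i)) (by
    rw [← ENNReal.ofReal_sum_of_nonneg fun i _ => x.2.1 i, x.2.2, ENNReal.ofReal_one])

theorem simplexPMF_toReal {X : Type*} [Fintype X] (x : stdSimplex ℝ X) (i : X) :
    (simplexPMF x i).toReal = x.1 i := by
  simp only [simplexPMF, PMF.ofFintype_apply]
  exact ENNReal.toReal_ofReal (x.2.1 i)

theorem exists_simplexPMF_eq {X : Type*} [Fintype X] (p : PMF X) :
    ∃ x : stdSimplex ℝ X, simplexPMF x = p := by
  refine ⟨⟨fun i => (p i).toReal, fun i => ENNReal.toReal_nonneg, ?_⟩, ?_⟩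
  · rw [← ENNReal.toReal_sum fun i _ => p.apply_ne_top i, ← tsum_fintype (L := .unconditional _),
      p.tsum_coe, ENNReal.toReal_one]
  · ext i
    simp [simplexPMF, PMF.ofFintype_apply, ENNReal.ofReal_toReal (p.apply_ne_top i)]

theorem continuous_optValueAux (r : Fin H → S → A × B → ℝ) (β : ℕ → ℝ) (N : Counters S A B H)
    (ν : MinPolicy S A B H) (n h : ℕ) (hh : h + n = H) (τ : PastPairs S A B h) (s : S) :
    Continuous fun x : (h : Fin H) → PastPairs S A B h → S → stdSimplex ℝ A =>
      optValueAux r β N (fun h τ s => simplexPMF (x h τ s)) ν n h hh τ s := by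
  induction n generalizing h s with
  | zero => simpa only [optValueAux] using continuous_const
  | succ n ih =>
    simp only [optValueAux, simplexPMF_toReal]
    refine continuous_finsetSum _ fun a _ => continuous_finsetSum _ fun b _ => ?_
    refine Continuous.mul (Continuous.mul ?_ continuous_const) ?_
    · exact (continuous_apply a).comp (continuous_subtype_val.comp
        ((continuous_apply s).comp ((continuous_apply τ).comp (continuous_apply _))))
    · refine Continuous.min ?_ continuous_const
      refine (Continuous.add ?_ continuous_const).add continuous_const
      exact continuous_finsetSum _ fun s' _ => continuous_const.mul (ih _ _ _ _)

/-- The optimistic best response to a mixture exists. -/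
theorem exists_max_optMixValue [Nonempty A] (s₁ : S) (r : Fin H → S → A × B → ℝ) (β : ℕ → ℝ)
    (N : Counters S A B H) (Ψ : Finset (MinPolicy S A B H)) (w : MinPolicy S A B H → ℝ) :
    ∃ μ : MaxPolicy S A B H, ∀ μ' : MaxPolicy S A B H,
      optMixValue s₁ r β N Ψ w μ' ≤ optMixValue s₁ r β N Ψ w μ := by
  have hc : Continuous fun x : (h : Fin H) → PastPairs S A B h → S → stdSimplex ℝ A =>
      optMixValue s₁ r β N Ψ w (fun h τ s => simplexPMF (x h τ s)) := by
    refine continuous_finsetSum _ fun ν _ => continuous_const.mul ?_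
    exact continuous_optValueAux r β N ν H 0 _ _ s₁
  obtain ⟨x, -, hx⟩ := isCompact_univ.exists_isMaxOn Set.univ_nonempty hc.continuousOn
  refine ⟨fun h τ s => simplexPMF (x h τ s), fun μ' => ?_⟩
  choose y hy using fun h τ s => exists_simplexPMF_eq (μ' h τ s)
  have h1 : (fun h τ s => simplexPMF (y h τ s)) = μ' := by
    funext h τ s
    exact hy h τ s
  have h2 := hx (Set.mem_univ y)
  rw [← h1]
  exact h2

/-- An optimistic best response to the mixture with weights `w`. -/
def optBestResponse [Nonempty A] (s₁ : S) (r : Fin H → S → A × B → ℝ) (β : ℕ → ℝ)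
    (N : Counters S A B H) (Ψ : Finset (MinPolicy S A B H)) (w : MinPolicy S A B H → ℝ) :
    MaxPolicy S A B H :=
  Classical.choose (exists_max_optMixValue s₁ r β N Ψ w)

/-- `UCB-BestResponse`: one optimistic best response for each mixture in an `ε`-cover (in `ℓ¹`) of
the simplex over `Ψ`, namely for the mixtures all of whose weights are multiples of `1 / m`, where
`m = ⌈|Ψ| / ε⌉`. -/
def ucbBestResponse [Nonempty A] (s₁ : S) (r : Fin H → S → A × B → ℝ) (β : ℕ → ℝ) (ε : ℝ)
    (N : Counters S A B H) (Ψ : Finset (MinPolicy S A B H)) : Finset (MaxPolicy S A B H) :=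
  let m : ℕ := ⌈(Ψ.card : ℝ) / ε⌉₊
  (Finset.piAntidiag Ψ m).image fun j => optBestResponse s₁ r β N Ψ fun ν => (j ν : ℝ) / m

theorem ucbBestResponse_nonempty [Nonempty A] (s₁ : S) (r : Fin H → S → A × B → ℝ) (β : ℕ → ℝ)
    (ε : ℝ) (N : Counters S A B H) (Ψ : Finset (MinPolicy S A B H)) :
    (ucbBestResponse s₁ r β ε N Ψ).Nonempty := by
  refine Finset.Nonempty.image ?_ _
  rcases Ψ.eq_empty_or_nonempty with rfl | ⟨ν, hν⟩
  · simp
  · refine ⟨Pi.single ν ⌈(Ψ.card : ℝ) / ε⌉₊, ?_⟩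
    rw [Finset.mem_piAntidiag]
    refine ⟨?_, fun i hi => ?_⟩
    · rw [Finset.sum_pi_single' ν _ Ψ, if_pos hν]
    · by_contra hne
      have h : i ≠ ν := by
        rintro rfl
        exact hne hν
      exact hi (Pi.single_eq_of_ne h _)

/-- The exponential-weights distribution on a nonempty finite set `Φ`: proportional to
`exp (g μ)`. -/
def expWeights {X : Type*} (Φ : Finset X) (hΦ : Φ.Nonempty) (g : X → ℝ) : PMF X :=
  PMF.ofFinset
    (fun μ => if μ ∈ Φ then ENNReal.ofReal (Real.exp (g μ) / ∑ μ' ∈ Φ, Real.exp (g μ')) else 0) Φ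
    (by
      have hpos : 0 < ∑ μ' ∈ Φ, Real.exp (g μ') := Finset.sum_pos (fun i _ => Real.exp_pos _) hΦ
      rw [Finset.sum_congr rfl fun i hi => if_pos hi,
        ← ENNReal.ofReal_sum_of_nonneg fun i _ => div_nonneg (Real.exp_pos _).le hpos.le,
        ← Finset.sum_div, div_self hpos.ne', ENNReal.ofReal_one])
    (fun _ ha => if_neg ha)

/-- The memory of adaptive OP-EXP3 at the beginning of an episode. -/
structure LearnerState (S A B : Type*) (H : ℕ) where
  /-- the latest counters -/
  count : Counters S A B H
  /-- the lazy counters -/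
  lazyCount : Counters S A B H
  /-- the opponent policies encountered so far -/
  oppSet : Finset (MinPolicy S A B H)
  /-- the current set of player policies -/
  polSet : Finset (MaxPolicy S A B H)
  polSet_nonempty : polSet.Nonempty
  /-- the number of episodes since the last restart of EXP3 -/
  rounds : ℕ
  /-- the sum over these episodes of the optimistic values of each player policy -/
  gain : MaxPolicy S A B H → ℝ

section Learner

variable [Nonempty A] (s₁ : S) (r : Fin H → S → A × B → ℝ) (β : ℕ → ℝ) (ε : ℝ)

/-- The memory right after a restart of EXP3. -/
def LearnerState.restart (N : Counters S A B H) (Ψ : Finset (MinPolicy S A B H)) :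
    LearnerState S A B H where
  count := N
  lazyCount := N
  oppSet := Ψ
  polSet := ucbBestResponse s₁ r β ε N Ψ
  polSet_nonempty := ucbBestResponse_nonempty s₁ r β ε N Ψ
  rounds := 0
  gain := fun _ => 0

/-- The distribution `p^k` from which the learner draws its policy: anytime EXP3, with learning rate
`√(log |Φ| / (t H²))` in the `t`-th episode after a restart. -/
def LearnerState.play (σ : LearnerState S A B H) : PMF (MaxPolicy S A B H) :=
  expWeights σ.polSet σ.polSet_nonempty fun μ =>
    Real.sqrt (Real.log σ.polSet.card / (((σ.rounds : ℝ) + 1) * (H : ℝ) ^ 2)) * σ.gain μ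

/-- The update at the end of an episode. If the opponent policy is new or one of the counters
`N_h(s, a)` has doubled (a first visit included) since the last restart, the lazy counters are set
to the latest ones, the player policy set is recomputed and EXP3 is restarted. Otherwise this is one
round of EXP3, with the optimistic values based on the lazy counters as gains. -/
def LearnerState.update (σ : LearnerState S A B H) (e : Episode S A B H) : LearnerState S A B H :=
  if e.opp ∉ σ.oppSet ∨ ∃ h s a,
      max 1 (2 * σ.lazyCount.visits h s a) ≤ (σ.count.record e.traj).visits h s a then
    LearnerState.restart s₁ r β ε (σ.count.record e.traj) (insert e.opp σ.oppSet)
  else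
    { σ with
      count := σ.count.record e.traj
      rounds := σ.rounds + 1
      gain := fun μ => σ.gain μ + optValue s₁ r β σ.lazyCount μ e.opp }

/-- The memory of adaptive OP-EXP3 after the given episodes (in chronological order). -/
def LearnerState.after (l : List (Episode S A B H)) : LearnerState S A B H :=
  l.foldl (LearnerState.update s₁ r β ε) (LearnerState.restart s₁ r β ε (fun _ _ _ _ => 0) ∅)

end Learner

/-- The law of the first `K` episodes, in chronological order, when the learner runs adaptive
OP-EXP3 with bonus function `β` and accuracy `ε` against an adaptive, possibly randomized opponent:
`opp l` is the distribution of the opponent's next policy when the episodes so far are `l`. The two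
players' policies for an episode are drawn independently given the past, and both are revealed at
the end of the episode. -/
def MarkovGame.runLaw [Nonempty A] (G : MarkovGame S A B H) (β : ℕ → ℝ) (ε : ℝ)
    (opp : List (Episode S A B H) → PMF (MinPolicy S A B H)) :
    ℕ → PMF (List (Episode S A B H))
  | 0 => PMF.pure []
  | K + 1 =>
      (G.runLaw β ε opp K).bind fun l =>
        (LearnerState.after G.start G.reward β ε l).play.bind fun μ =>
          (opp l).bind fun ν =>
            (G.trajLaw μ ν H le_rfl).map fun x => l ++ [⟨μ, ν, x⟩]

end Game

/-- `ι = log (K H S A / δ)`. -/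
def logFactor (K H S A : ℕ) (δ : ℝ) : ℝ := Real.log ((K : ℝ) * H * S * A / δ)

/-- The bonus function `β(t) = c H √(S ι / max{t, 1})`. -/
def bonus (c : ℝ) (H S : ℕ) (ι : ℝ) (t : ℕ) : ℝ :=
  c * H * Real.sqrt (S * ι / max (t : ℝ) 1)

end

open scoped ENNReal

/-! The regret against a fixed general policy `μ` is split episode by episode, with optimistic
values computed from the lazy counters as intermediaries: value of `μ` ≤ its optimistic value
(optimism); optimistic value of `μ` minus the mean optimistic value of the learner's random policy
(EXP3 regret); that mean minus the optimistic value of the policy drawn (`policyNoise`); optimistic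
value of the drawn policy minus its true value, at most twice the expected bonuses, i.e. the
realized bonuses plus `bonusNoise`.

Optimism has to hold for history-dependent policies and values that depend on the data, so the
empirical transitions must integrate all functions with values in `[0, H]` simultaneously
(`MarkovGame.Accurate`). This follows from a bound on the probabilities of all `2 ^ S` events: for
each event an exponential supermartingale moves only when the given state-action pair is visited,
and `runLaw_exists_event_deviation_le` takes the union over events, pairs, times and visit counts.
The error `√(S ι / N)` is the shape of the bonus.

Between two restarts the lazy counters are frozen and all opponent policies belong to the known set.
The cumulative optimistic gain is then linear in the frequencies of these policies, so the best
response to a nearby grid point competes with every `μ` (`exists_mem_ucbBestResponse`), and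
exponential weights on a set with logarithmic size at most `3 |Ψ| ι` suffice. A potential argument
(`restartCount_le`) bounds the number `T` of restarts by `|Ψ|` plus `H S A` times a logarithm. By
Cauchy–Schwarz over the runs, EXP3 costs order `H √(|Ψ| ι (T + 1) k)`, which gives the second and
third terms of the bound.

Doubling keeps the lazy and the current counters within a constant factor, so a pigeonhole sum
bounds the realized bonuses by order `H² S √(A ι k)`: the first term. The two noises are sums of
martingale differences, handled by Azuma–Hoeffding and a union over `k`. A restart episode is
charged `2 H`; the total `2 H T` is absorbed when `A ≤ k`, and for `k ≤ A` the trivial bound `H k`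
is good enough. -/

/-! ### Hoeffding's lemma and exponential weights with decreasing learning rates. -/

theorem exp_mul_le_cosh_add_sinh {x B t : ℝ} (hB : 0 < B) (hx : |x| ≤ B) :
    Real.exp (t * x) ≤ Real.cosh (t * B) + x / B * Real.sinh (t * B) := by
  obtain ⟨h1, h2⟩ := abs_le.1 hx
  have hl : -1 ≤ x / B := by rw [le_div_iff₀ hB]; linarith
  have hu : x / B ≤ 1 := by rw [div_le_iff₀ hB]; linarith
  have h0 := convexOn_exp.2
  -- The graph of `exp` lies below its chord over `[-tB, tB]`, and `t * x` is the convex combination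
  -- of the endpoints with weights `(1 ± x / B) / 2`.
  have h := h0 (Set.mem_univ (t * B)) (Set.mem_univ (-(t * B)))
    (show 0 ≤ (1 + x / B) / 2 by linarith) (show 0 ≤ (1 - x / B) / 2 by linarith) (by ring)
  have e : ((1 + x / B) / 2) • (t * B) + ((1 - x / B) / 2) • (-(t * B)) = t * x := by
    simp only [smul_eq_mul]
    field_simp
    ring
  rw [e] at h
  refine h.trans_eq ?_
  rw [Real.cosh_eq, Real.sinh_eq]
  simp only [smul_eq_mul]
  ring

/-- Hoeffding's lemma for a finitely supported centred variable. -/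
theorem sum_mul_exp_le_of_centered {X : Type*} {s : Finset X} {w x : X → ℝ} {B : ℝ} (t : ℝ)
    (hB : 0 < B) (hw : ∀ i ∈ s, 0 ≤ w i) (hw1 : ∑ i ∈ s, w i = 1) (hx : ∀ i ∈ s, |x i| ≤ B)
    (hx0 : ∑ i ∈ s, w i * x i = 0) :
    ∑ i ∈ s, w i * Real.exp (t * x i) ≤ Real.exp (t ^ 2 * B ^ 2 / 2) := by
  calc ∑ i ∈ s, w i * Real.exp (t * x i)
      ≤ ∑ i ∈ s, w i * (Real.cosh (t * B) + x i / B * Real.sinh (t * B)) :=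
        Finset.sum_le_sum fun i hi =>
          mul_le_mul_of_nonneg_left (exp_mul_le_cosh_add_sinh hB (hx i hi)) (hw i hi)
    _ = (∑ i ∈ s, w i) * Real.cosh (t * B)
          + (∑ i ∈ s, w i * x i) * (Real.sinh (t * B) / B) := by
        rw [Finset.sum_mul, Finset.sum_mul, ← Finset.sum_add_distrib]
        exact Finset.sum_congr rfl fun i _ => by ring
    _ = Real.cosh (t * B) := by rw [hw1, hx0]; ring
    _ ≤ _ := by
        refine (Real.cosh_le_exp_half_sq _).trans_eq ?_
        rw [mul_pow]

/-- Hoeffding's lemma for a finitely supported variable with values in `[0, B]`. -/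
theorem sum_mul_exp_sub_mean_le {X : Type*} {s : Finset X} {w x : X → ℝ} {B : ℝ} (t : ℝ)
    (hB : 0 < B) (hw : ∀ i ∈ s, 0 ≤ w i) (hw1 : ∑ i ∈ s, w i = 1)
    (hx : ∀ i ∈ s, x i ∈ Set.Icc 0 B) :
    ∑ i ∈ s, w i * Real.exp (t * (x i - ∑ j ∈ s, w j * x j)) ≤ Real.exp (t ^ 2 * B ^ 2 / 2) := by
  have h0 : 0 ≤ ∑ j ∈ s, w j * x j :=
    Finset.sum_nonneg fun i hi => mul_nonneg (hw i hi) (hx i hi).1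
  have h1 : ∑ j ∈ s, w j * x j ≤ B :=
    calc ∑ j ∈ s, w j * x j ≤ ∑ j ∈ s, w j * B :=
          Finset.sum_le_sum fun i hi => mul_le_mul_of_nonneg_left (hx i hi).2 (hw i hi)
      _ = B := by rw [← Finset.sum_mul, hw1, one_mul]
  -- Only `|x i - mean| ≤ B` is used, hence `B ^ 2 / 2` instead of the sharp `B ^ 2 / 8`.
  refine sum_mul_exp_le_of_centered t hB hw hw1 (fun i hi => ?_) ?_
  · have := hx i hi
    exact abs_le.2 ⟨by linarith [this.1], by linarith [this.2]⟩
  · simp only [mul_sub, Finset.sum_sub_distrib, ← Finset.sum_mul, hw1, one_mul, sub_self]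

/-- The certainty equivalent of the uniform lottery over the values of `g` on `Φ`, for the
exponential utility with parameter `η`. -/
noncomputable def expMean {X : Type*} (Φ : Finset X) (η : ℝ) (g : X → ℝ) : ℝ :=
  Real.log (∑ i ∈ Φ, (Φ.card : ℝ)⁻¹ * Real.exp (η * g i)) / η

/-- This is the power mean inequality with exponent `η / η'`. It allows the learning rate to
decrease from round to round without any loss in the potential. -/
theorem expMean_mono {X : Type*} {Φ : Finset X} (hΦ : Φ.Nonempty) {η η' : ℝ} (h0 : 0 < η')
    (h : η' ≤ η) (g : X → ℝ) : expMean Φ η' g ≤ expMean Φ η g := by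
  have hc : (0 : ℝ) < (Φ.card : ℝ)⁻¹ := by
    have := hΦ.card_pos
    positivity
  have hpos : ∀ t : ℝ, 0 < ∑ i ∈ Φ, (Φ.card : ℝ)⁻¹ * Real.exp (t * g i) := fun t =>
    Finset.sum_pos (fun i _ => mul_pos hc (Real.exp_pos _)) hΦ
  have key := Real.rpow_arith_mean_le_arith_mean_rpow Φ (fun _ => (Φ.card : ℝ)⁻¹)
    (fun i => Real.exp (η' * g i)) (fun _ _ => hc.le)
    (by
      have := hΦ.card_pos
      rw [Finset.sum_const, nsmul_eq_mul]
      field_simp)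
    (fun _ _ => (Real.exp_pos _).le) (p := η / η') (by rwa [le_div_iff₀ h0, one_mul])
  have e : ∀ i, Real.exp (η' * g i) ^ (η / η') = Real.exp (η * g i) := fun i => by
    rw [← Real.exp_mul]
    congr 1
    field_simp
  simp only [e] at key
  have hl := Real.log_le_log (Real.rpow_pos_of_pos (hpos η') _) key
  rw [Real.log_rpow (hpos η')] at hl
  have hη : 0 < η := h0.trans_le h
  unfold expMean
  rw [div_le_div_iff₀ h0 hη]
  calc _ = η / η' * Real.log (∑ i ∈ Φ, (Φ.card : ℝ)⁻¹ * Real.exp (η' * g i)) * η' := by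
        field_simp
    _ ≤ _ := mul_le_mul_of_nonneg_right hl h0.le

/-- Keeping only the term of `μ` in the average loses the factor `1 / |Φ|`, which is the price `log
|Φ| / η` for competing with the best element. -/
theorem le_expMean_add {X : Type*} {Φ : Finset X} {η : ℝ} (h0 : 0 < η) (g : X → ℝ) {μ : X}
    (hμ : μ ∈ Φ) : g μ ≤ expMean Φ η g + Real.log Φ.card / η := by
  have hcard : (0 : ℝ) < Φ.card := by exact_mod_cast Finset.card_pos.2 ⟨μ, hμ⟩
  have h : (Φ.card : ℝ)⁻¹ * Real.exp (η * g μ) ≤ ∑ i ∈ Φ, (Φ.card : ℝ)⁻¹ * Real.exp (η * g i) :=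
    Finset.single_le_sum (f := fun i => (Φ.card : ℝ)⁻¹ * Real.exp (η * g i))
      (fun i _ => by positivity) hμ
  have hl := Real.log_le_log (by positivity) h
  rw [Real.log_mul (by positivity) (by positivity), Real.log_exp, Real.log_inv] at hl
  unfold expMean
  rw [← add_div, le_div_iff₀ h0]
  linarith

theorem expWeights_toReal {X : Type*} {Φ : Finset X} (hΦ : Φ.Nonempty) (g : X → ℝ) {μ : X}
    (hμ : μ ∈ Φ) :
    (expWeights Φ hΦ g μ).toReal = Real.exp (g μ) / ∑ μ' ∈ Φ, Real.exp (g μ') := by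
  simp only [expWeights, PMF.ofFinset_apply, if_pos hμ]
  exact ENNReal.toReal_ofReal
    (div_nonneg (Real.exp_pos _).le (Finset.sum_nonneg fun _ _ => (Real.exp_pos _).le))

theorem sum_expWeights_toReal {X : Type*} {Φ : Finset X} (hΦ : Φ.Nonempty) (g : X → ℝ) :
    ∑ μ ∈ Φ, (expWeights Φ hΦ g μ).toReal = 1 := by
  rw [Finset.sum_congr rfl fun μ hμ => expWeights_toReal hΦ g hμ, ← Finset.sum_div]
  exact div_self (Finset.sum_pos (fun i _ => Real.exp_pos _) hΦ).ne'

/-- One step of exponential weights. -/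
theorem expMean_add_le {X : Type*} {Φ : Finset X} (hΦ : Φ.Nonempty) {η B : ℝ} (h0 : 0 < η)
    (hB : 0 < B) (G g : X → ℝ) (hg : ∀ μ ∈ Φ, g μ ∈ Set.Icc 0 B) :
    expMean Φ η (fun μ => G μ + g μ) ≤ expMean Φ η G
      + ∑ μ ∈ Φ, (expWeights Φ hΦ (fun ν => η * G ν) μ).toReal * g μ + η * B ^ 2 / 2 := by
  set w : X → ℝ := fun μ => (expWeights Φ hΦ (fun ν => η * G ν) μ).toReal with hw
  set m := ∑ μ ∈ Φ, w μ * g μ with hm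
  have hc : (0 : ℝ) < (Φ.card : ℝ)⁻¹ := by
    have := hΦ.card_pos
    positivity
  have hZ : 0 < ∑ μ ∈ Φ, Real.exp (η * G μ) := Finset.sum_pos (fun i _ => Real.exp_pos _) hΦ
  have hoeff := sum_mul_exp_sub_mean_le η hB (s := Φ) (w := w) (x := g)
    (fun _ _ => ENNReal.toReal_nonneg) (sum_expWeights_toReal hΦ _) hg
  rw [← hm] at hoeff
  -- The new average is the old one times the exponential moment of `g` under the current weights;
  -- Hoeffding's lemma bounds the second factor.
  have hsum : ∑ i ∈ Φ, (Φ.card : ℝ)⁻¹ * Real.exp (η * (G i + g i))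
      = (∑ i ∈ Φ, (Φ.card : ℝ)⁻¹ * Real.exp (η * G i))
        * (Real.exp (η * m) * ∑ i ∈ Φ, w i * Real.exp (η * (g i - m))) := by
    rw [← Finset.mul_sum, ← Finset.mul_sum, mul_assoc]
    congr 1
    rw [Finset.mul_sum, Finset.mul_sum]
    refine Finset.sum_congr rfl fun i hi => ?_
    simp only [hw]
    rw [expWeights_toReal hΦ _ hi, mul_add, Real.exp_add, mul_sub, Real.exp_sub]
    field_simp
  have hpos1 : 0 < ∑ i ∈ Φ, (Φ.card : ℝ)⁻¹ * Real.exp (η * G i) :=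
    Finset.sum_pos (fun i _ => mul_pos hc (Real.exp_pos _)) hΦ
  have hpos2 : 0 < ∑ i ∈ Φ, w i * Real.exp (η * (g i - m)) :=
    Finset.sum_pos (fun i hi => mul_pos (by
      simp only [hw]
      rw [expWeights_toReal hΦ _ hi]
      exact div_pos (Real.exp_pos _) hZ) (Real.exp_pos _)) hΦ
  have hl := Real.log_le_log hpos2 hoeff
  rw [Real.log_exp] at hl
  unfold expMean
  rw [hsum, Real.log_mul hpos1.ne' (by positivity), Real.log_mul (by positivity) hpos2.ne',
    Real.log_exp]
  have : η * m + Real.log (∑ i ∈ Φ, w i * Real.exp (η * (g i - m)))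
      ≤ (m + η * B ^ 2 / 2) * η := by nlinarith
  rw [add_div, add_assoc]
  refine add_le_add le_rfl ?_
  rwa [div_le_iff₀ h0]

/-- Equivalent to `(√(n + 1) - √n) ^ 2 ≥ 0`. The telescoping form serves both the learning rates and
the bonuses. -/
theorem one_div_sqrt_succ_le (n : ℕ) :
    1 / Real.sqrt ((n : ℝ) + 1) ≤ 2 * (Real.sqrt ((n : ℝ) + 1) - Real.sqrt n) := by
  have hp : 0 < Real.sqrt ((n : ℝ) + 1) := Real.sqrt_pos.2 (by positivity)
  rw [div_le_iff₀ hp]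
  have h1 := Real.sq_sqrt (show (0 : ℝ) ≤ (n : ℝ) + 1 by positivity)
  have h2 := Real.sq_sqrt (show (0 : ℝ) ≤ n by positivity)
  nlinarith [sq_nonneg (Real.sqrt ((n : ℝ) + 1) - Real.sqrt n)]

theorem sum_range_inv_sqrt_le (n : ℕ) :
    ∑ i ∈ Finset.range n, 1 / Real.sqrt ((i : ℝ) + 1) ≤ 2 * Real.sqrt n := by
  induction n with
  | zero => simp
  | succ n ih =>
    rw [Finset.sum_range_succ]
    have h := one_div_sqrt_succ_le n
    push_cast
    linarith

/-- The regret of exponential weights with learning rates `√(log |Φ| / (t B²))`. -/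
theorem expWeights_regret_le {X : Type*} {Φ : Finset X} (hΦ : Φ.Nonempty) {B : ℝ} (hB : 0 < B)
    (g : ℕ → X → ℝ) (hg : ∀ i, ∀ μ ∈ Φ, g i μ ∈ Set.Icc 0 B) (n : ℕ) {μ : X} (hμ : μ ∈ Φ) :
    ∑ i ∈ Finset.range n, g i μ - ∑ i ∈ Finset.range n, ∑ μ' ∈ Φ,
      (expWeights Φ hΦ (fun ν => Real.sqrt (Real.log Φ.card / (((i : ℝ) + 1) * B ^ 2)) *
        ∑ j ∈ Finset.range i, g j ν) μ').toReal * g i μ'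
      ≤ 3 * B * Real.sqrt (n * Real.log Φ.card) := by
  rcases Nat.lt_or_ge 1 Φ.card with hcard | hcard
  swap
  -- With a single policy `log |Φ| = 0`, so the rates vanish and `expMean` is useless; but then
  -- there is no regret.
  · obtain ⟨a, rfl⟩ := Finset.card_eq_one.1 (le_antisymm hcard hΦ.card_pos)
    obtain rfl := Finset.mem_singleton.1 hμ
    have : ∀ G : X → ℝ, (expWeights {μ} hΦ G μ).toReal = 1 := fun G => by
      simpa using sum_expWeights_toReal hΦ G
    simp [this]
  have hlog : 0 < Real.log Φ.card := Real.log_pos (by exact_mod_cast hcard)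
  set η : ℕ → ℝ := fun i => Real.sqrt (Real.log Φ.card / (((i : ℝ) + 1) * B ^ 2)) with hη
  have hηpos : ∀ i, 0 < η i := fun i => Real.sqrt_pos.2 (by positivity)
  have hηanti : ∀ i, η (i + 1) ≤ η i := fun i => by
    refine Real.sqrt_le_sqrt (div_le_div_of_nonneg_left hlog.le (by positivity) ?_)
    push_cast
    nlinarith [sq_nonneg B]
  have hηeq : ∀ i, η i = Real.sqrt (Real.log Φ.card) / B * (1 / Real.sqrt ((i : ℝ) + 1)) := by
    intro i
    simp only [hη]
    rw [Real.sqrt_div hlog.le, Real.sqrt_mul (by positivity), Real.sqrt_sq hB.le]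
    field_simp
  set mix : ℕ → ℝ := fun i => ∑ μ' ∈ Φ,
      (expWeights Φ hΦ (fun ν => η i * ∑ j ∈ Finset.range i, g j ν) μ').toReal * g i μ' with hmix
  have main : ∀ n, expMean Φ (η n) (fun ν => ∑ j ∈ Finset.range n, g j ν)
      ≤ ∑ i ∈ Finset.range n, mix i + ∑ i ∈ Finset.range n, η i * B ^ 2 / 2 := by
    intro n
    induction n with
    | zero =>
      have : (Φ.card : ℝ) ≠ 0 := by positivity
      simp [expMean, this]
    | succ n ih =>
      -- Lower the rate from `η n` to `η (n + 1)` first, then take one step at the rate `η n` that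
      -- the round really used.
      refine (expMean_mono hΦ (hηpos _) (hηanti n) _).trans ?_
      have := expMean_add_le hΦ (hηpos n) hB (fun ν => ∑ j ∈ Finset.range n, g j ν) (g n) (hg n)
      simp only [Finset.sum_range_succ] at *
      linarith
  rcases n.eq_zero_or_pos with rfl | hn
  · simp
  have h1 := le_expMean_add (hηpos n) (fun ν => ∑ j ∈ Finset.range n, g j ν) hμ
  have h2 := main n
  have h3 : ∑ i ∈ Finset.range n, η i * B ^ 2 / 2 ≤ B * Real.sqrt (n * Real.log Φ.card) := by
    have : ∑ i ∈ Finset.range n, η i * B ^ 2 / 2 = Real.sqrt (Real.log Φ.card) * B / 2 *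
        ∑ i ∈ Finset.range n, 1 / Real.sqrt ((i : ℝ) + 1) := by
      rw [Finset.mul_sum]
      refine Finset.sum_congr rfl fun i _ => ?_
      rw [hηeq]
      field_simp
    rw [this, Real.sqrt_mul (Nat.cast_nonneg n)]
    calc _ ≤ Real.sqrt (Real.log Φ.card) * B / 2 * (2 * Real.sqrt n) :=
          mul_le_mul_of_nonneg_left (sum_range_inv_sqrt_le n) (by positivity)
      _ = _ := by ring
  have h4 : Real.log Φ.card / η n ≤ 2 * B * Real.sqrt (n * Real.log Φ.card) := by
    rw [div_le_iff₀ (hηpos n), hηeq, Real.sqrt_mul (Nat.cast_nonneg n)]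
    have hs := Real.mul_self_sqrt hlog.le
    -- The potential after `n` rounds is taken at the rate of round `n + 1`; this shift costs at
    -- most the factor 2, whence `3 = 1 + 2` in the bound.
    have hn' : Real.sqrt ((n : ℝ) + 1) ≤ 2 * Real.sqrt n := by
      rw [← Real.sqrt_sq (show (0 : ℝ) ≤ 2 by norm_num), ← Real.sqrt_mul (by norm_num)]
      refine Real.sqrt_le_sqrt ?_
      have : (1 : ℝ) ≤ n := by exact_mod_cast hn
      linarith
    have hp : 0 < Real.sqrt ((n : ℝ) + 1) := Real.sqrt_pos.2 (by positivity)
    calc Real.log Φ.card = Real.log Φ.card * 1 := by ring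
      _ ≤ Real.log Φ.card * (2 * Real.sqrt n / Real.sqrt ((n : ℝ) + 1)) :=
          mul_le_mul_of_nonneg_left (by rwa [le_div_iff₀ hp, one_mul]) hlog.le
      _ = (Real.sqrt (Real.log Φ.card) * Real.sqrt (Real.log Φ.card))
            * (2 * Real.sqrt n / Real.sqrt ((n : ℝ) + 1)) := by rw [hs]
      _ = _ := by field_simp
  simp only [hmix, hη] at *
  linarith

/-! ### Expectations under discrete laws. -/

/-- The expectation of a nonnegative function under a discrete law. -/
noncomputable def pmfMean {X : Type*} (p : PMF X) (F : X → ℝ≥0∞) : ℝ≥0∞ := ∑' x, p x * F x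

section PmfMean

variable {X Y : Type*}

theorem pmfMean_mono {p : PMF X} {F F' : X → ℝ≥0∞} (h : ∀ x ∈ p.support, F x ≤ F' x) :
    pmfMean p F ≤ pmfMean p F' := by
  refine ENNReal.tsum_le_tsum fun x => ?_
  by_cases hx : x ∈ p.support
  · exact mul_le_mul_right (h x hx) _
  · simp [(PMF.apply_eq_zero_iff p x).2 hx]

theorem pmfMean_congr {p : PMF X} {F F' : X → ℝ≥0∞} (h : ∀ x ∈ p.support, F x = F' x) :
    pmfMean p F = pmfMean p F' :=
  le_antisymm (pmfMean_mono fun x hx => (h x hx).le) (pmfMean_mono fun x hx => (h x hx).ge)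

theorem pmfMean_const (p : PMF X) (a : ℝ≥0∞) : pmfMean p (fun _ => a) = a := by
  simp [pmfMean, ENNReal.tsum_mul_right, p.tsum_coe]

theorem pmfMean_le {p : PMF X} {F : X → ℝ≥0∞} {a : ℝ≥0∞} (h : ∀ x ∈ p.support, F x ≤ a) :
    pmfMean p F ≤ a :=
  (pmfMean_mono h).trans_eq (pmfMean_const p a)

theorem pmfMean_mul_left (p : PMF X) (a : ℝ≥0∞) (F : X → ℝ≥0∞) :
    pmfMean p (fun x => a * F x) = a * pmfMean p F := by
  rw [pmfMean, pmfMean, ← ENNReal.tsum_mul_left]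
  exact tsum_congr fun x => mul_left_comm _ _ _

theorem pmfMean_pure (a : X) (F : X → ℝ≥0∞) : pmfMean (PMF.pure a) F = F a := by
  rw [pmfMean, tsum_eq_single a fun x hx => by simp [hx]]
  simp

theorem pmfMean_bind (p : PMF X) (q : X → PMF Y) (F : Y → ℝ≥0∞) :
    pmfMean (p.bind q) F = pmfMean p fun x => pmfMean (q x) F := by
  simp only [pmfMean, PMF.bind_apply, ← ENNReal.tsum_mul_right, ← ENNReal.tsum_mul_left]
  rw [ENNReal.tsum_comm]
  simp only [mul_assoc]

theorem pmfMean_map (p : PMF X) (f : X → Y) (F : Y → ℝ≥0∞) :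
    pmfMean (p.map f) F = pmfMean p fun x => F (f x) := by
  rw [PMF.map, pmfMean_bind]
  simp [pmfMean_pure]

theorem pmfMean_comm (p : PMF X) (q : PMF Y) (F : X → Y → ℝ≥0∞) :
    pmfMean p (fun x => pmfMean q fun y => F x y) =
      pmfMean q fun y => pmfMean p fun x => F x y := by
  simp only [pmfMean, ← ENNReal.tsum_mul_left]
  rw [ENNReal.tsum_comm]
  exact tsum_congr fun y => tsum_congr fun x => mul_left_comm _ _ _

theorem toOuterMeasure_le_pmfMean (p : PMF X) (s : Set X) {F : X → ℝ≥0∞}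
    (h : ∀ x ∈ s, 1 ≤ F x) : p.toOuterMeasure s ≤ pmfMean p F := by
  rw [PMF.toOuterMeasure_apply]
  refine ENNReal.tsum_le_tsum fun x => ?_
  by_cases hx : x ∈ s
  · simpa [hx] using mul_le_mul_right (h x hx) (p x)
  · simp [hx]

/-- Markov's inequality in exponential form. -/
theorem toOuterMeasure_le_exp_neg (p : PMF X) {W : X → ℝ} {s : Set X} {L : ℝ}
    (h1 : pmfMean p (fun x => ENNReal.ofReal (Real.exp (W x))) ≤ 1) (hs : ∀ x ∈ s, L ≤ W x) :
    p.toOuterMeasure s ≤ ENNReal.ofReal (Real.exp (-L)) := by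
  calc p.toOuterMeasure s
      ≤ pmfMean p fun x => ENNReal.ofReal (Real.exp (-L)) * ENNReal.ofReal (Real.exp (W x)) := by
        refine toOuterMeasure_le_pmfMean p s fun x hx => ?_
        rw [← ENNReal.ofReal_mul (Real.exp_pos _).le, ← Real.exp_add, ENNReal.one_le_ofReal,
          Real.one_le_exp_iff]
        linarith [hs x hx]
    _ = ENNReal.ofReal (Real.exp (-L)) * pmfMean p fun x => ENNReal.ofReal (Real.exp (W x)) :=
        pmfMean_mul_left _ _ _
    _ ≤ ENNReal.ofReal (Real.exp (-L)) * 1 := mul_le_mul_right h1 _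
    _ = _ := mul_one _

theorem pmfMean_ofReal {p : PMF X} {s : Finset X} (hs : p.support ⊆ ↑s) {f : X → ℝ}
    (hf : ∀ x ∈ s, 0 ≤ f x) :
    pmfMean p (fun x => ENNReal.ofReal (f x)) = ENNReal.ofReal (∑ x ∈ s, (p x).toReal * f x) := by
  rw [pmfMean, tsum_eq_sum (s := s), ENNReal.ofReal_sum_of_nonneg]
  · refine Finset.sum_congr rfl fun x _ => ?_
    rw [ENNReal.ofReal_mul ENNReal.toReal_nonneg, ENNReal.ofReal_toReal (p.apply_ne_top x)]
  · exact fun x hx => mul_nonneg ENNReal.toReal_nonneg (hf x hx)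
  · intro x hx
    have : x ∉ p.support := fun h => hx (hs h)
    simp [(PMF.apply_eq_zero_iff p x).2 this]

theorem sum_toReal_eq_one {p : PMF X} {s : Finset X} (hs : p.support ⊆ ↑s) :
    ∑ x ∈ s, (p x).toReal = 1 := by
  have h := pmfMean_ofReal hs (f := fun _ => 1) fun _ _ => zero_le_one
  simp only [ENNReal.ofReal_one, pmfMean_const, mul_one] at h
  have h2 := congrArg ENNReal.toReal h
  rw [ENNReal.toReal_ofReal (Finset.sum_nonneg fun _ _ => ENNReal.toReal_nonneg)] at h2
  simpa using h2.symm

end PmfMean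

/-! ### Adapted sequences, exponential supermartingales and Azuma–Hoeffding. -/

/-- The sum of `D (prefix) (next element)` along a list that extends `pre`. -/
def prefixSumFrom {E : Type*} (D : List E → E → ℝ) : List E → List E → ℝ
  | _, [] => 0
  | pre, e :: l => D pre e + prefixSumFrom D (pre ++ [e]) l

/-- The sum of `D (prefix) (next element)` along a list. -/
def prefixSum {E : Type*} (D : List E → E → ℝ) (l : List E) : ℝ := prefixSumFrom D [] l

theorem prefixSumFrom_append {E : Type*} (D : List E → E → ℝ) (l pre : List E) (e : E) :
    prefixSumFrom D pre (l ++ [e]) = prefixSumFrom D pre l + D (pre ++ l) e := by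
  induction l generalizing pre with
  | nil => simp [prefixSumFrom]
  | cons a l ih => simp [prefixSumFrom, ih, add_assoc]

theorem prefixSum_append {E : Type*} (D : List E → E → ℝ) (l : List E) (e : E) :
    prefixSum D (l ++ [e]) = prefixSum D l + D l e := by
  rw [prefixSum, prefixSumFrom_append, List.nil_append, prefixSum]

theorem prefixSum_range {E : Type*} (D : List E → E → ℝ) (e : ℕ → E) (k : ℕ) :
    prefixSum D ((List.range k).map e) =
      ∑ t ∈ Finset.range k, D ((List.range t).map e) (e t) := by
  induction k with
  | zero => simp [prefixSum, prefixSumFrom]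
  | succ k ih =>
    rw [List.range_succ, List.map_append, List.map_singleton, prefixSum_append, ih,
      Finset.sum_range_succ]

/-- The law of the first `K` elements of a sequence in which the law of the next element is a
function `step` of the elements so far. -/
noncomputable def sequenceLaw {E : Type*} (step : List E → PMF E) : ℕ → PMF (List E)
  | 0 => PMF.pure []
  | K + 1 => (sequenceLaw step K).bind fun l => (step l).map fun e => l ++ [e]

section SequenceLaw

variable {E : Type*} {step : List E → PMF E}

theorem length_of_mem_support_sequenceLaw {K : ℕ} {l : List E}
    (hl : l ∈ (sequenceLaw step K).support) : l.length = K := by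
  induction K generalizing l with
  | zero =>
    simp only [sequenceLaw, PMF.support_pure, Set.mem_singleton_iff] at hl
    simp [hl]
  | succ K ih =>
    simp only [sequenceLaw, PMF.mem_support_bind_iff, PMF.mem_support_map_iff] at hl
    obtain ⟨l', hl', e, -, rfl⟩ := hl
    simp [ih hl']

theorem forall_mem_of_mem_support_sequenceLaw {P : E → Prop}
    (hP : ∀ l, ∀ e ∈ (step l).support, P e) {K : ℕ} {l : List E}
    (hl : l ∈ (sequenceLaw step K).support) : ∀ e ∈ l, P e := by
  induction K generalizing l with
  | zero =>
    simp only [sequenceLaw, PMF.support_pure, Set.mem_singleton_iff] at hl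
    simp [hl]
  | succ K ih =>
    simp only [sequenceLaw, PMF.mem_support_bind_iff, PMF.mem_support_map_iff] at hl
    obtain ⟨l', hl', e, he, rfl⟩ := hl
    intro e' he'
    rcases List.mem_append.1 he' with h | h
    · exact ih hl' e' h
    · rw [List.mem_singleton.1 h]
      exact hP l' e he

/-- Later elements do not change the law of the prefix, so events about each time `k ≤ K` can all be
measured under the one law of length `K`. -/
theorem pmfMean_sequenceLaw_take {k K : ℕ} (hk : k ≤ K) (F : List E → ℝ≥0∞) :
    pmfMean (sequenceLaw step K) (fun l => F (l.take k)) = pmfMean (sequenceLaw step k) F := by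
  induction K, hk using Nat.le_induction with
  | base =>
    refine pmfMean_congr fun l hl => ?_
    rw [List.take_of_length_le (length_of_mem_support_sequenceLaw hl).le]
  | succ K hK ih =>
    rw [← ih, sequenceLaw, pmfMean_bind]
    refine pmfMean_congr fun l hl => ?_
    rw [pmfMean_map, ← pmfMean_const (step l) (F (l.take k))]
    refine pmfMean_congr fun e _ => ?_
    rw [List.take_append_of_le_length]
    rw [length_of_mem_support_sequenceLaw hl]
    exact hK

/-- The exponential of the prefix sum is a supermartingale: conditionally on the past, each new
factor has mean at most one. -/
theorem pmfMean_exp_prefixSum_le_one {W : List E → E → ℝ}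
    (hW : ∀ l, pmfMean (step l) (fun e => ENNReal.ofReal (Real.exp (W l e))) ≤ 1) (k : ℕ) :
    pmfMean (sequenceLaw step k) (fun l => ENNReal.ofReal (Real.exp (prefixSum W l))) ≤ 1 := by
  induction k with
  | zero => simp [sequenceLaw, pmfMean_pure, prefixSum, prefixSumFrom]
  | succ k ih =>
    rw [sequenceLaw, pmfMean_bind]
    refine le_trans (pmfMean_mono fun l _ => ?_) ih
    rw [pmfMean_map]
    simp only [prefixSum_append, Real.exp_add, ENNReal.ofReal_mul (Real.exp_pos _).le]
    rw [pmfMean_mul_left]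
    exact (mul_le_mul_right (hW l) _).trans_eq (mul_one _)

/-- A tail bound for an adapted exponential supermartingale at a fixed time. -/
theorem sequenceLaw_tail {W : List E → E → ℝ}
    (hW : ∀ l, pmfMean (step l) (fun e => ENNReal.ofReal (Real.exp (W l e))) ≤ 1) {k K : ℕ}
    (hk : k ≤ K) (L : ℝ) :
    (sequenceLaw step K).toOuterMeasure {l | L ≤ prefixSum W (l.take k)}
      ≤ ENNReal.ofReal (Real.exp (-L)) := by
  refine toOuterMeasure_le_exp_neg _ (W := fun l => prefixSum W (l.take k)) ?_
    fun l hl => by simpa using hl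
  rw [pmfMean_sequenceLaw_take hk fun l => ENNReal.ofReal (Real.exp (prefixSum W l))]
  exact pmfMean_exp_prefixSum_le_one hW k

theorem prefixSum_affine (D : List E → E → ℝ) (a b : ℝ) (l : List E) :
    prefixSum (fun l e => a * D l e - b) l = a * prefixSum D l - l.length * b := by
  induction l using List.reverseRecOn with
  | nil => simp [prefixSum, prefixSumFrom]
  | append_singleton l e ih =>
    rw [prefixSum_append, prefixSum_append, ih]
    simp only [List.length_append, List.length_singleton]
    push_cast
    ring

/-- The Azuma–Hoeffding inequality. -/
theorem sequenceLaw_azuma {D : List E → E → ℝ} {B : ℝ} (hB : 0 < B)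
    (hD : ∀ t l, pmfMean (step l) (fun e => ENNReal.ofReal (Real.exp (t * D l e)))
      ≤ ENNReal.ofReal (Real.exp (t ^ 2 * B ^ 2 / 2)))
    {k K : ℕ} (hk : 1 ≤ k) (hkK : k ≤ K) {L : ℝ} (hL : 0 ≤ L) :
    (sequenceLaw step K).toOuterMeasure
      {l | l.length = K ∧ B * Real.sqrt (2 * k * L) ≤ prefixSum D (l.take k)}
      ≤ ENNReal.ofReal (Real.exp (-L)) := by
  have hk0 : (0 : ℝ) < k := by exact_mod_cast hk
  -- The optimal parameter: at the threshold the linear term is `2 * L`, while the compensator over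
  -- `k` steps is `L`.
  set t : ℝ := Real.sqrt (2 * L / k) / B with ht
  have ht2 : t ^ 2 * B ^ 2 = 2 * L / k := by
    rw [ht, div_pow, Real.sq_sqrt (by positivity)]
    field_simp
  have htb : t * (B * Real.sqrt (2 * k * L)) = 2 * L := by
    rw [ht, show ∀ x y : ℝ, x / B * (B * y) = x * y from fun x y => by field_simp,
      ← Real.sqrt_mul (by positivity)]
    rw [show 2 * L / k * (2 * k * L) = (2 * L) ^ 2 by field_simp]
    exact Real.sqrt_sq (by positivity)
  refine le_trans ?_ (sequenceLaw_tail (step := step)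
    (W := fun l e => t * D l e - t ^ 2 * B ^ 2 / 2) (fun l => ?_) hkK L)
  · refine MeasureTheory.measure_mono fun l hl => ?_
    simp only [Set.mem_ofPred_eq] at hl ⊢
    rw [prefixSum_affine, List.length_take, hl.1, min_eq_left hkK, ht2]
    have := mul_le_mul_of_nonneg_left hl.2 (show 0 ≤ t by positivity)
    rw [htb] at this
    have e : (k : ℝ) * (2 * L / k / 2) = L := by field_simp
    linarith
  · simp only [sub_eq_add_neg, Real.exp_add, mul_comm (Real.exp (t * _)),
      ENNReal.ofReal_mul (Real.exp_pos _).le]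
    rw [pmfMean_mul_left]
    refine (mul_le_mul_right (hD t l) _).trans_eq ?_
    rw [← ENNReal.ofReal_mul (Real.exp_pos _).le, ← Real.exp_add]
    simp

end SequenceLaw

/-! ### Real expectations on finite types. -/

/-- The expectation of a real function under a law on a finite type. -/
noncomputable def finMean {X : Type*} [Fintype X] (p : PMF X) (f : X → ℝ) : ℝ :=
  ∑ x, (p x).toReal * f x

section FinMean

variable {X Y : Type*} [Fintype X] [Fintype Y]

theorem finMean_mono {p : PMF X} {f g : X → ℝ} (h : ∀ x, f x ≤ g x) : finMean p f ≤ finMean p g :=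
  Finset.sum_le_sum fun x _ => mul_le_mul_of_nonneg_left (h x) ENNReal.toReal_nonneg

theorem finMean_const (p : PMF X) (a : ℝ) : finMean p (fun _ => a) = a := by
  rw [finMean, ← Finset.sum_mul, sum_toReal_eq_one (p := p) (s := Finset.univ) (by simp), one_mul]

theorem finMean_add (p : PMF X) (f g : X → ℝ) :
    finMean p (fun x => f x + g x) = finMean p f + finMean p g := by
  simp only [finMean, mul_add, Finset.sum_add_distrib]

theorem finMean_bind (p : PMF X) (q : X → PMF Y) (f : Y → ℝ) :
    finMean (p.bind q) f = finMean p fun x => finMean (q x) f := by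
  have h : ∀ y, ((p.bind q) y).toReal = ∑ x, (p x).toReal * (q x y).toReal := fun y => by
    rw [PMF.bind_apply, tsum_fintype, ENNReal.toReal_sum fun x _ =>
      ENNReal.mul_ne_top (p.apply_ne_top x) ((q x).apply_ne_top y)]
    simp only [ENNReal.toReal_mul]
  simp only [finMean, h, Finset.sum_mul, Finset.mul_sum]
  rw [Finset.sum_comm]
  simp only [mul_assoc]

theorem finMean_pure (a : X) (f : X → ℝ) : finMean (PMF.pure a) f = f a := by
  rw [finMean, Finset.sum_eq_single a] <;> simp +contextual

theorem finMean_map (p : PMF X) (g : X → Y) (f : Y → ℝ) :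
    finMean (p.map g) f = finMean p fun x => f (g x) := by
  rw [PMF.map, finMean_bind]
  simp [finMean_pure]

theorem finMean_mem_Icc {p : PMF X} {f : X → ℝ} {a b : ℝ} (h : ∀ x, f x ∈ Set.Icc a b) :
    finMean p f ∈ Set.Icc a b :=
  ⟨(finMean_const p a).symm.le.trans (finMean_mono fun x => (h x).1),
    (finMean_mono fun x => (h x).2).trans_eq (finMean_const p b)⟩

theorem pmfMean_exp_mul_mean_sub_le (p : PMF X) {f : X → ℝ} {B : ℝ} (hB : 0 < B)
    (hf : ∀ x, f x ∈ Set.Icc 0 B) (t : ℝ) :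
    pmfMean p (fun x => ENNReal.ofReal (Real.exp (t * (finMean p f - f x))))
      ≤ ENNReal.ofReal (Real.exp (t ^ 2 * B ^ 2 / 2)) := by
  rw [pmfMean_ofReal (s := Finset.univ) (by simp) fun _ _ => (Real.exp_pos _).le]
  refine ENNReal.ofReal_le_ofReal ?_
  have := sum_mul_exp_sub_mean_le (-t) hB (s := Finset.univ) (w := fun x => (p x).toReal) (x := f)
    (fun _ _ => ENNReal.toReal_nonneg) (sum_toReal_eq_one (by simp)) fun x _ => hf x
  rw [neg_sq] at this
  refine le_trans (le_of_eq ?_) this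
  refine Finset.sum_congr rfl fun x _ => ?_
  rw [show ∀ u v : ℝ, -t * (u - v) = t * (v - u) from fun u v => by ring]
  rfl

end FinMean

/-! ### Trajectory laws, policy evaluation and optimism. -/

section Trajectories

variable {S A B : Type*} {H : ℕ}

theorem nextState_extend_castSucc {h : ℕ} (x : Traj S A B h) (a : A × B) (s' : S) (i : Fin h) :
    nextState ((x.1.extend x.2 a, s') : Traj S A B (h + 1)) i.castSucc = nextState x i := by
  have hi : (i : ℕ) + 1 < h + 1 := by omega
  simp only [nextState, Fin.val_castSucc, hi, dif_pos, PastPairs.extend]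
  by_cases hh : (i : ℕ) + 1 < h
  · rw [dif_pos hh]
    exact congrArg Prod.fst
      (Fin.snoc_castSucc (α := fun _ => S × (A × B)) (x.2, a) x.1 ⟨(i : ℕ) + 1, hh⟩)
  · rw [dif_neg hh]
    have : (⟨(i : ℕ) + 1, hi⟩ : Fin (h + 1)) = Fin.last h := Fin.ext (by simp; omega)
    rw [this, Fin.snoc_last]

theorem nextState_extend_last {h : ℕ} (τ : PastPairs S A B h) (s : S) (a : A × B) (s' : S) :
    nextState ((τ.extend s a, s') : Traj S A B (h + 1)) (Fin.last h) = s' := by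
  simp [nextState]

theorem extend_castSucc {h : ℕ} (τ : PastPairs S A B h) (s : S) (a : A × B) (i : Fin h) :
    τ.extend s a i.castSucc = τ i :=
  Fin.snoc_castSucc (α := fun _ => S × (A × B)) (s, a) τ i

theorem extend_last {h : ℕ} (τ : PastPairs S A B h) (s : S) (a : A × B) :
    τ.extend s a (Fin.last h) = (s, a) :=
  Fin.snoc_last (α := fun _ => S × (A × B)) (s, a) τ

/-- Conditionally on the past, the factors of the product below have mean at most one. -/
theorem pmfMean_trajLaw_prod_le_one (G : MarkovGame S A B H) (μ : MaxPolicy S A B H)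
    (ν : MinPolicy S A B H) (u : Fin H → S → A × B → S → ℝ≥0∞)
    (hu : ∀ i s a, pmfMean (G.trans i s a) (u i s a) ≤ 1) (h : ℕ) (hh : h ≤ H) :
    pmfMean (G.trajLaw μ ν h hh) (fun x =>
      ∏ i : Fin h, u (Fin.castLE hh i) (x.1 i).1 (x.1 i).2 (nextState x i)) ≤ 1 := by
  induction h with
  | zero => simp [MarkovGame.trajLaw, pmfMean_pure]
  | succ h ih =>
    refine le_trans ?_ (ih (Nat.le_of_succ_le hh))
    rw [MarkovGame.trajLaw, pmfMean_bind]
    refine pmfMean_mono fun x _ => ?_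
    rw [pmfMean_bind]
    refine pmfMean_le fun a _ => ?_
    rw [pmfMean_bind]
    refine pmfMean_le fun b _ => ?_
    rw [pmfMean_map]
    simp only [Fin.prod_univ_castSucc, nextState_extend_castSucc, nextState_extend_last,
      extend_castSucc, extend_last]
    rw [pmfMean_mul_left]
    exact (mul_le_mul_right (hu _ _ _) _).trans_eq (mul_one _)

theorem empirical_nonneg [Fintype S] (N : Counters S A B H) (h : Fin H) (s : S) (a : A × B)
    (s' : S) :
    0 ≤ N.empirical h s a s' := by
  unfold Counters.empirical
  split_ifs <;> positivity

/-- The total reward of a (partial) trajectory when `q` is the reward function. -/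
def trajSum {h : ℕ} (q : Fin H → S → A × B → ℝ) (hh : h ≤ H) (x : Traj S A B h) : ℝ :=
  ∑ i : Fin h, q (Fin.castLE hh i) (x.1 i).1 (x.1 i).2

theorem trajSum_extend {h : ℕ} (q : Fin H → S → A × B → ℝ) (hh : h + 1 ≤ H) (x : Traj S A B h)
    (a : A × B) (s' : S) :
    trajSum q hh ((x.1.extend x.2 a, s') : Traj S A B (h + 1)) =
      trajSum q (Nat.le_of_succ_le hh) x + q ⟨h, hh⟩ x.2 a := by
  simp only [trajSum, Fin.sum_univ_castSucc, extend_castSucc, extend_last]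
  rfl

variable [Fintype S] [Fintype A] [Fintype B]

theorem finMean_trajLaw_succ (G : MarkovGame S A B H) (μ : MaxPolicy S A B H)
    (ν : MinPolicy S A B H) (h : ℕ) (hh : h + 1 ≤ H) (f : Traj S A B (h + 1) → ℝ) :
    finMean (G.trajLaw μ ν (h + 1) hh) f =
      finMean (G.trajLaw μ ν h (Nat.le_of_succ_le hh)) fun x =>
        finMean (μ ⟨h, hh⟩ x.1 x.2) fun a => finMean (ν ⟨h, hh⟩ x.1 x.2) fun b =>
          finMean (G.trans ⟨h, hh⟩ x.2 (a, b)) fun s' => f (x.1.extend x.2 (a, b), s') := by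
  simp only [MarkovGame.trajLaw, finMean_bind, finMean_map]

theorem optValueAux_succ (r : Fin H → S → A × B → ℝ) (β : ℕ → ℝ) (N : Counters S A B H)
    (μ : MaxPolicy S A B H) (ν : MinPolicy S A B H) (n h : ℕ) (hn : h + (n + 1) = H)
    (hh : h + 1 ≤ H) (τ : PastPairs S A B h) (s : S) :
    optValueAux r β N μ ν (n + 1) h hn τ s =
      finMean (μ ⟨h, hh⟩ τ s) fun a => finMean (ν ⟨h, hh⟩ τ s) fun b =>
        min ((∑ s' : S, N.empirical ⟨h, hh⟩ s (a, b) s' *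
                optValueAux r β N μ ν n (h + 1) (by omega) (τ.extend s (a, b)) s')
              + r ⟨h, hh⟩ s (a, b) + β (N.visits ⟨h, hh⟩ s (a, b)))
          ((n : ℝ) + 1) := by
  simp only [optValueAux, finMean, Finset.mul_sum, mul_assoc]

theorem optValueAux_mem_Icc {r : Fin H → S → A × B → ℝ} {β : ℕ → ℝ} (hr : ∀ h s a, 0 ≤ r h s a)
    (hβ : ∀ n, 0 ≤ β n) (N : Counters S A B H) (μ : MaxPolicy S A B H) (ν : MinPolicy S A B H)
    (n h : ℕ) (hn : h + n = H) (τ : PastPairs S A B h) (s : S) :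
    optValueAux r β N μ ν n h hn τ s ∈ Set.Icc (0 : ℝ) n := by
  induction n generalizing h s with
  | zero => simp [optValueAux]
  | succ n ih =>
    rw [optValueAux_succ r β N μ ν n h hn (by omega)]
    refine finMean_mem_Icc fun a => finMean_mem_Icc fun b => ⟨le_min ?_ (by positivity), ?_⟩
    · refine add_nonneg (add_nonneg ?_ (hr _ _ _)) (hβ _)
      exact Finset.sum_nonneg fun s' _ =>
        mul_nonneg (empirical_nonneg _ _ _ _ _) (ih _ _ _ _).1
    · push_cast
      exact min_le_right _ _

theorem optValue_mem_Icc {r : Fin H → S → A × B → ℝ} {β : ℕ → ℝ} (hr : ∀ h s a, 0 ≤ r h s a)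
    (hβ : ∀ n, 0 ≤ β n) (s₁ : S) (N : Counters S A B H) (μ : MaxPolicy S A B H)
    (ν : MinPolicy S A B H) : optValue s₁ r β N μ ν ∈ Set.Icc (0 : ℝ) H :=
  optValueAux_mem_Icc hr hβ N μ ν H 0 _ _ _

/-- The counters `N` are accurate for the game `G`, with error bounds `β`: the empirical
transitions integrate every function with values in `[0, H]` up to the error `β`. -/
def MarkovGame.Accurate (G : MarkovGame S A B H) (β : ℕ → ℝ) (N : Counters S A B H) : Prop :=
  ∀ (h : Fin H) (s : S) (a : A × B) (g : S → ℝ), (∀ s', g s' ∈ Set.Icc (0 : ℝ) H) →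
    |∑ s', N.empirical h s a s' * g s' - finMean (G.trans h s a) g| ≤ β (N.visits h s a)

/-- Policy evaluation that overestimates the Bellman backup with reward `q` at every step
overestimates the value, and conversely. -/
theorem finMean_trajSum_le_of_backup {G : MarkovGame S A B H} {μ : MaxPolicy S A B H}
    {ν : MinPolicy S A B H} {r q : Fin H → S → A × B → ℝ} {β : ℕ → ℝ} {N : Counters S A B H}
    (hq : ∀ (n h : ℕ) (hh : h + 1 ≤ H) (hn : h + 1 + n = H) (τ : PastPairs S A B (h + 1)) (s : S)
      (a : A × B),
      q ⟨h, hh⟩ s a + finMean (G.trans ⟨h, hh⟩ s a) (optValueAux r β N μ ν n (h + 1) hn τ)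
        ≤ min ((∑ s' : S, N.empirical ⟨h, hh⟩ s a s' * optValueAux r β N μ ν n (h + 1) hn τ s')
              + r ⟨h, hh⟩ s a + β (N.visits ⟨h, hh⟩ s a)) ((n : ℝ) + 1))
    (n h : ℕ) (hh : h ≤ H) (hn : h + n = H) :
    finMean (G.trajLaw μ ν H le_rfl) (trajSum q le_rfl) ≤
      finMean (G.trajLaw μ ν h hh) fun x =>
        trajSum q hh x + optValueAux r β N μ ν n h hn x.1 x.2 := by
  -- The mean of (reward collected so far plus optimistic value to go) does not increase with the
  -- step `h`; at `h = H` it is the mean total reward.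
  induction n generalizing h with
  | zero =>
    obtain rfl : h = H := by omega
    simp [optValueAux, finMean]
  | succ n ih =>
    refine (ih (h + 1) (by omega) (by omega)).trans ?_
    rw [finMean_trajLaw_succ]
    refine finMean_mono fun x => ?_
    rw [optValueAux_succ r β N μ ν n h hn (by omega), ← finMean_const (μ ⟨h, by omega⟩ x.1 x.2)
      (trajSum q hh x), ← finMean_add]
    refine finMean_mono fun a => ?_
    rw [← finMean_const (ν ⟨h, by omega⟩ x.1 x.2) (trajSum q hh x), ← finMean_add]
    refine finMean_mono fun b => ?_
    simp only [trajSum_extend, add_assoc, finMean_add, finMean_const]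
    simpa only [add_assoc] using
      add_le_add_right (hq n h (by omega) (by omega) (x.1.extend x.2 (a, b)) x.2 (a, b)) _

theorem le_finMean_trajSum_of_backup {G : MarkovGame S A B H} {μ : MaxPolicy S A B H}
    {ν : MinPolicy S A B H} {r q : Fin H → S → A × B → ℝ} {β : ℕ → ℝ} {N : Counters S A B H}
    (hq : ∀ (n h : ℕ) (hh : h + 1 ≤ H) (hn : h + 1 + n = H) (τ : PastPairs S A B (h + 1)) (s : S)
      (a : A × B),
      min ((∑ s' : S, N.empirical ⟨h, hh⟩ s a s' * optValueAux r β N μ ν n (h + 1) hn τ s')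
              + r ⟨h, hh⟩ s a + β (N.visits ⟨h, hh⟩ s a)) ((n : ℝ) + 1)
        ≤ q ⟨h, hh⟩ s a + finMean (G.trans ⟨h, hh⟩ s a) (optValueAux r β N μ ν n (h + 1) hn τ))
    (n h : ℕ) (hh : h ≤ H) (hn : h + n = H) :
    (finMean (G.trajLaw μ ν h hh) fun x =>
        trajSum q hh x + optValueAux r β N μ ν n h hn x.1 x.2) ≤
      finMean (G.trajLaw μ ν H le_rfl) (trajSum q le_rfl) := by
  induction n generalizing h with
  | zero =>
    obtain rfl : h = H := by omega
    simp [optValueAux, finMean]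
  | succ n ih =>
    refine le_trans ?_ (ih (h + 1) (by omega) (by omega))
    rw [finMean_trajLaw_succ]
    refine finMean_mono fun x => ?_
    rw [optValueAux_succ r β N μ ν n h hn (by omega), ← finMean_const (μ ⟨h, by omega⟩ x.1 x.2)
      (trajSum q hh x), ← finMean_add]
    refine finMean_mono fun a => ?_
    rw [← finMean_const (ν ⟨h, by omega⟩ x.1 x.2) (trajSum q hh x), ← finMean_add]
    refine finMean_mono fun b => ?_
    simp only [trajSum_extend, add_assoc, finMean_add, finMean_const]
    simpa only [add_assoc] using
      add_le_add_right (hq n h (by omega) (by omega) (x.1.extend x.2 (a, b)) x.2 (a, b)) _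

theorem value_eq_finMean (G : MarkovGame S A B H) (μ : MaxPolicy S A B H)
    (ν : MinPolicy S A B H) :
    G.value μ ν = finMean (G.trajLaw μ ν H le_rfl) (trajSum G.reward le_rfl) := rfl

theorem value_mem_Icc (G : MarkovGame S A B H) (μ : MaxPolicy S A B H) (ν : MinPolicy S A B H) :
    G.value μ ν ∈ Set.Icc (0 : ℝ) H := by
  rw [value_eq_finMean]
  refine finMean_mem_Icc fun x => ⟨Finset.sum_nonneg fun i _ => (G.reward_mem _ _ _).1, ?_⟩
  refine (Finset.sum_le_sum fun i _ => (G.reward_mem _ _ _).2).trans_eq ?_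
  simp

section Accurate

variable {G : MarkovGame S A B H} {β : ℕ → ℝ} {N : Counters S A B H}

/-- The empty trajectory has collected nothing, whatever `q` is. Hence the same optimistic value can
be compared with total rewards for different `q`. -/
theorem optValue_eq_finMean (G : MarkovGame S A B H) (β : ℕ → ℝ) (N : Counters S A B H)
    (q : Fin H → S → A × B → ℝ) (μ : MaxPolicy S A B H) (ν : MinPolicy S A B H) :
    optValue G.start G.reward β N μ ν = finMean (G.trajLaw μ ν 0 (Nat.zero_le H)) fun x =>
        trajSum q (Nat.zero_le H) x
          + optValueAux G.reward β N μ ν H 0 (Nat.zero_add H) x.1 x.2 := by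
  rw [MarkovGame.trajLaw, finMean_pure]
  simp [optValue, trajSum]

theorem optValueAux_mem_Icc_horizon (hβ : ∀ n, 0 ≤ β n) (μ : MaxPolicy S A B H)
    (ν : MinPolicy S A B H) (n h : ℕ) (hn : h + n = H) (τ : PastPairs S A B h) (s : S) :
    optValueAux G.reward β N μ ν n h hn τ s ∈ Set.Icc (0 : ℝ) H := by
  have := optValueAux_mem_Icc (fun h s a => (G.reward_mem h s a).1) hβ N μ ν n h hn τ s
  refine ⟨this.1, this.2.trans ?_⟩
  exact_mod_cast (show n ≤ H by omega)

/-- Optimism. -/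
theorem MarkovGame.Accurate.value_le_optValue (hN : G.Accurate β N) (hβ : ∀ n, 0 ≤ β n)
    (μ : MaxPolicy S A B H) (ν : MinPolicy S A B H) :
    G.value μ ν ≤ optValue G.start G.reward β N μ ν := by
  rw [value_eq_finMean, optValue_eq_finMean G β N G.reward]
  refine finMean_trajSum_le_of_backup (fun n h hh hn τ s a => le_min ?_ ?_) _ _ _ _
  · have := (abs_le.1 (hN ⟨h, hh⟩ s a _ fun s' =>
      optValueAux_mem_Icc_horizon (G := G) (N := N) hβ μ ν n (h + 1) hn τ s')).1
    linarith
  -- The truncation does no harm: the reward is at most 1 and the value to go at most `n`.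
  · have h1 := (finMean_mem_Icc (p := G.trans ⟨h, hh⟩ s a) fun s' =>
      optValueAux_mem_Icc (fun h s a => (G.reward_mem h s a).1) hβ N μ ν n (h + 1) hn τ s').2
    have h2 := (G.reward_mem ⟨h, hh⟩ s a).2
    linarith

/-- The optimistic value exceeds the value by at most twice the expected sum of the bonuses. -/
theorem MarkovGame.Accurate.optValue_le (hN : G.Accurate β N) (hβ : ∀ n, 0 ≤ β n)
    (μ : MaxPolicy S A B H) (ν : MinPolicy S A B H) :
    optValue G.start G.reward β N μ ν ≤ G.value μ ν + finMean (G.trajLaw μ ν H le_rfl)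
      (trajSum (fun h s a => 2 * β (N.visits h s a)) le_rfl) := by
  rw [value_eq_finMean, ← finMean_add, optValue_eq_finMean G β N
    (fun h s a => G.reward h s a + 2 * β (N.visits h s a))]
  refine (le_finMean_trajSum_of_backup (fun n h hh hn τ s a => ?_) _ _ _ _).trans_eq ?_
  -- One `β` is the bonus itself, the other one the estimation error.
  · have := (abs_le.1 (hN ⟨h, hh⟩ s a _ fun s' =>
      optValueAux_mem_Icc_horizon (G := G) (N := N) hβ μ ν n (h + 1) hn τ s')).2
    refine (min_le_left _ _).trans ?_
    linarith
  · exact congrArg _ (funext fun x => Finset.sum_add_distrib)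

end Accurate

end Trajectories

/-! ### Counters along a run and concentration of the empirical transitions. -/

section Run

variable {S A B : Type*} {H : ℕ}

/-- The visitation counters after the given episodes. -/
noncomputable def episodeCount (l : List (Episode S A B H)) : Counters S A B H :=
  l.foldl (fun N e => N.record e.traj) fun _ _ _ _ => 0

theorem episodeCount_append (l : List (Episode S A B H)) (e : Episode S A B H) :
    episodeCount (l ++ [e]) = (episodeCount l).record e.traj := by
  simp [episodeCount]

variable [Fintype S]

theorem visits_record (N : Counters S A B H) (x : Traj S A B H) (h : Fin H) (s : S) (a : A × B) :
    (N.record x).visits h s a = N.visits h s a + if x.1 h = (s, a) then 1 else 0 := by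
  simp only [Counters.visits, Counters.record, Finset.sum_add_distrib]
  congr 1
  split_ifs with hx
  · simp [hx]
  · simp [hx]

theorem sum_visits_record [Fintype A] [Fintype B] (N : Counters S A B H) (x : Traj S A B H)
    (h : Fin H) :
    ∑ p : S × (A × B), (N.record x).visits h p.1 p.2 =
      ∑ p : S × (A × B), N.visits h p.1 p.2 + 1 := by
  simp only [visits_record, Finset.sum_add_distrib]
  congr 1
  simp

theorem sum_visits_episodeCount [Fintype A] [Fintype B] (l : List (Episode S A B H))
    (h : Fin H) : ∑ p : S × (A × B), (episodeCount l).visits h p.1 p.2 = l.length := by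
  induction l using List.reverseRecOn with
  | nil => simp [episodeCount, Counters.visits]
  | append_singleton l e ih => simp [episodeCount_append, sum_visits_record, ih]

theorem visits_episodeCount_le (l : List (Episode S A B H)) (h : Fin H) (s : S) (a : A × B) :
    (episodeCount l).visits h s a ≤ l.length := by
  induction l using List.reverseRecOn with
  | nil => simp [episodeCount, Counters.visits]
  | append_singleton l e ih =>
    rw [episodeCount_append, visits_record, List.length_append, List.length_singleton]
    split_ifs <;> omega

/-- The exponent of the supermartingale that controls the empirical probability of `U` after the
visits of `(h, s, a)`. -/
noncomputable def visitExponent (G : MarkovGame S A B H) (h : Fin H) (s : S) (a : A × B)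
    (U : Finset S) (t : ℝ) (x : Traj S A B H) : ℝ :=
  if x.1 h = (s, a) then
    t * ((if nextState x h ∈ U then 1 else 0) - ∑ s' ∈ U, (G.trans h s a s').toReal) - t ^ 2 / 2
  else 0

/-- Whatever the policies, the state that follows a visit of `(s, a)` at step `h` has law `G.trans h
s a`. Only the factor of step `h` is nontrivial, and Hoeffding's lemma with range 1 explains the
compensator `t ^ 2 / 2`. -/
theorem pmfMean_visitExponent_le_one (G : MarkovGame S A B H) (h : Fin H) (s : S) (a : A × B)
    (U : Finset S) (t : ℝ) (μ : MaxPolicy S A B H) (ν : MinPolicy S A B H) :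
    pmfMean (G.trajLaw μ ν H le_rfl)
      (fun x => ENNReal.ofReal (Real.exp (visitExponent G h s a U t x))) ≤ 1 := by
  set f : S → ℝ := fun s' => if s' ∈ U then 1 else 0 with hf
  have hmean : finMean (G.trans h s a) f = ∑ s' ∈ U, (G.trans h s a s').toReal := by
    simp [finMean, hf]
  set u : Fin H → S → A × B → S → ℝ≥0∞ := fun i s₀ a₀ s' =>
    if i = h ∧ (s₀, a₀) = (s, a) then
      ENNReal.ofReal (Real.exp (-(t ^ 2 / 2))) *
        ENNReal.ofReal (Real.exp (-t * (finMean (G.trans h s a) f - f s')))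
    else 1 with hu
  refine le_trans (le_of_eq (pmfMean_congr fun x _ => ?_))
    (pmfMean_trajLaw_prod_le_one G μ ν u (fun i s₀ a₀ => ?_) H le_rfl)
  · rw [Finset.prod_eq_single h]
    · simp only [hu, visitExponent, ← hmean]
      have e : Fin.castLE le_rfl h = h := rfl
      simp only [e, true_and, Prod.mk.eta]
      split_ifs with hx hx'
      · rw [← ENNReal.ofReal_mul (Real.exp_pos _).le, ← Real.exp_add]
        congr 2
        simp only [hf]
        rw [if_pos hx']
        ring
      · rw [← ENNReal.ofReal_mul (Real.exp_pos _).le, ← Real.exp_add]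
        congr 2
        simp only [hf]
        rw [if_neg hx']
        ring
      · simp
    · intro i _ hi
      simp only [hu]
      rw [if_neg]
      exact fun hh => hi hh.1
    · simp
  · simp only [hu]
    split_ifs with hh
    · obtain ⟨rfl, hsa⟩ := hh
      obtain ⟨rfl, rfl⟩ := Prod.mk.inj hsa
      rw [pmfMean_mul_left]
      have := pmfMean_exp_mul_mean_sub_le (G.trans i s₀ a₀) one_pos (f := f)
        (fun x => by simp only [hf]; split_ifs <;> simp) (-t)
      refine (mul_le_mul_right this _).trans_eq ?_
      rw [← ENNReal.ofReal_mul (Real.exp_pos _).le, ← Real.exp_add]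
      simp
    · rw [pmfMean_const]

/-- The supermartingale depends on the run only through the counters of `(h, s, a)`, with time
measured by the number of visits. -/
theorem prefixSum_visitExponent (G : MarkovGame S A B H) (h : Fin H) (s : S) (a : A × B)
    (U : Finset S) (t : ℝ) (l : List (Episode S A B H)) :
    prefixSum (fun _ e => visitExponent G h s a U t e.traj) l =
      t * (∑ s' ∈ U, (episodeCount l h s a s' : ℝ)
          - (episodeCount l).visits h s a * ∑ s' ∈ U, (G.trans h s a s').toReal)
        - (episodeCount l).visits h s a * (t ^ 2 / 2) := by
  induction l using List.reverseRecOn with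
  | nil => simp [prefixSum, prefixSumFrom, episodeCount, Counters.visits]
  | append_singleton l e ih =>
    rw [prefixSum_append, ih, episodeCount_append, visits_record]
    simp only [Counters.record, visitExponent]
    push_cast
    rw [Finset.sum_add_distrib]
    split_ifs with hx hU
    · simp only [hx, true_and, Finset.sum_ite_eq, if_pos hU]
      ring
    · simp only [hx, true_and, Finset.sum_ite_eq, if_neg hU]
      ring
    · simp only [hx, false_and, if_false, Finset.sum_const_zero]
      ring

theorem sum_empirical (N : Counters S A B H) (h : Fin H) (s : S) (a : A × B) :
    ∑ s', N.empirical h s a s' = 1 := by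
  unfold Counters.empirical
  split_ifs with h0
  · rw [← Finset.sum_div, div_eq_one_iff_eq (by exact_mod_cast h0), Counters.visits]
    push_cast
    rfl
  · have : Nonempty S := ⟨s⟩
    simp

/-- Integrals of functions with values in `[0, H]` differ by at most `H` times the largest
difference of the probabilities of an event. -/
theorem sum_mul_sub_sum_mul_le {X : Type*} [Fintype X] {p q : X → ℝ} {d b : ℝ}
    (hd : ∀ U : Finset X, ∑ x ∈ U, p x - ∑ x ∈ U, q x ≤ d) (hb : 0 ≤ b) {g : X → ℝ}
    (hg : ∀ x, g x ∈ Set.Icc 0 b) : ∑ x, p x * g x - ∑ x, q x * g x ≤ b * d := by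
  -- The worst event: discarding the points with `p x < q x` can only increase the difference.
  set U : Finset X := Finset.univ.filter fun x => q x ≤ p x
  calc ∑ x, p x * g x - ∑ x, q x * g x = ∑ x, (p x - q x) * g x := by
        rw [← Finset.sum_sub_distrib]
        exact Finset.sum_congr rfl fun x _ => by ring
    _ ≤ ∑ x, if q x ≤ p x then (p x - q x) * b else 0 := by
        refine Finset.sum_le_sum fun x _ => ?_
        split_ifs with hx
        · exact mul_le_mul_of_nonneg_left (hg x).2 (by linarith)
        · exact mul_nonpos_of_nonpos_of_nonneg (by linarith) (hg x).1
    _ = b * (∑ x ∈ U, p x - ∑ x ∈ U, q x) := by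
        rw [← Finset.sum_filter, ← Finset.sum_mul, mul_comm, Finset.sum_sub_distrib]
    _ ≤ b * d := mul_le_mul_of_nonneg_left (hd U) hb

/-- One-sided bounds on events are enough: complementation is replaced by using both `g` and `H -
g`, as both measures have total mass one. -/
theorem accurate_of_forall_event (G : MarkovGame S A B H) (β : ℕ → ℝ) (N : Counters S A B H)
    {d : Fin H → S → A × B → ℝ}
    (hd : ∀ h s a (U : Finset S),
      ∑ s' ∈ U, N.empirical h s a s' - ∑ s' ∈ U, (G.trans h s a s').toReal ≤ d h s a)
    (hβ : ∀ h s a, H * d h s a ≤ β (N.visits h s a)) : G.Accurate β N := by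
  intro h s a g hg
  have hH : (0 : ℝ) ≤ H := Nat.cast_nonneg H
  have h1 := sum_mul_sub_sum_mul_le (hd h s a) hH hg
  have h2 := sum_mul_sub_sum_mul_le (hd h s a) hH (g := fun s' => H - g s')
    fun s' => ⟨by linarith [(hg s').2], by linarith [(hg s').1]⟩
  simp only [mul_sub, Finset.sum_sub_distrib, ← Finset.sum_mul, sum_empirical,
    sum_toReal_eq_one (p := G.trans h s a) (s := Finset.univ) (by simp)] at h2
  have h3 := hβ h s a
  rw [abs_le, finMean]
  constructor <;> linarith

variable [Fintype A] [Fintype B] [Nonempty A]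

/-- The law of the next episode. -/
noncomputable def MarkovGame.stepLaw (G : MarkovGame S A B H) (β : ℕ → ℝ) (ε : ℝ)
    (opp : List (Episode S A B H) → PMF (MinPolicy S A B H)) (l : List (Episode S A B H)) :
    PMF (Episode S A B H) :=
  (LearnerState.after G.start G.reward β ε l).play.bind fun μ =>
    (opp l).bind fun ν => (G.trajLaw μ ν H le_rfl).map fun x => ⟨μ, ν, x⟩

theorem runLaw_eq_sequenceLaw (G : MarkovGame S A B H) (β : ℕ → ℝ) (ε : ℝ)
    (opp : List (Episode S A B H) → PMF (MinPolicy S A B H)) (K : ℕ) :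
    G.runLaw β ε opp K = sequenceLaw (G.stepLaw β ε opp) K := by
  induction K with
  | zero => rfl
  | succ K ih =>
    rw [MarkovGame.runLaw, sequenceLaw, ih]
    simp only [MarkovGame.stepLaw, PMF.map_bind, PMF.map_comp]
    rfl

section Fixed

variable (G : MarkovGame S A B H) (β : ℕ → ℝ) (ε : ℝ)
  (opp : List (Episode S A B H) → PMF (MinPolicy S A B H))

/-- The two policies are independent given the past, so `ν` may be drawn first. The learner's draw
is then averaged against a fixed `ν`, even though the opponent is adaptive. -/
theorem pmfMean_stepLaw (l : List (Episode S A B H)) (F : Episode S A B H → ℝ≥0∞) :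
    pmfMean (G.stepLaw β ε opp l) F =
      pmfMean (opp l) fun ν => pmfMean (LearnerState.after G.start G.reward β ε l).play fun μ =>
        pmfMean (G.trajLaw μ ν H le_rfl) fun x => F ⟨μ, ν, x⟩ := by
  rw [MarkovGame.stepLaw, pmfMean_bind]
  simp only [pmfMean_bind, pmfMean_map]
  exact pmfMean_comm _ _ _

theorem opp_mem_of_mem_support_runLaw {Ψ : Finset (MinPolicy S A B H)}
    (hΨ : ∀ l, (opp l).support ⊆ ↑Ψ) {K : ℕ} {l : List (Episode S A B H)}
    (hl : l ∈ (G.runLaw β ε opp K).support) : ∀ e ∈ l, e.opp ∈ Ψ := by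
  rw [runLaw_eq_sequenceLaw] at hl
  refine forall_mem_of_mem_support_sequenceLaw (fun l e he => ?_) hl
  simp only [MarkovGame.stepLaw, PMF.mem_support_bind_iff, PMF.mem_support_map_iff] at he
  obtain ⟨μ, -, ν, hν, x, -, rfl⟩ := he
  exact hΨ l hν

theorem length_of_mem_support_runLaw {K : ℕ} {l : List (Episode S A B H)}
    (hl : l ∈ (G.runLaw β ε opp K).support) : l.length = K := by
  rw [runLaw_eq_sequenceLaw] at hl
  exact length_of_mem_support_sequenceLaw hl

theorem runLaw_visitExponent_tail (h : Fin H) (s : S) (a : A × B) (U : Finset S) (t : ℝ)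
    {k K : ℕ} (hk : k ≤ K) (L : ℝ) :
    (G.runLaw β ε opp K).toOuterMeasure
      {l | L ≤ prefixSum (fun _ e => visitExponent G h s a U t e.traj) (l.take k)}
      ≤ ENNReal.ofReal (Real.exp (-L)) := by
  rw [runLaw_eq_sequenceLaw]
  refine sequenceLaw_tail (fun l => ?_) hk L
  rw [pmfMean_stepLaw]
  exact pmfMean_le fun ν _ => pmfMean_le fun μ _ => pmfMean_visitExponent_le_one G h s a U t μ ν

/-- With high probability the events have accurate empirical probabilities, in all episodes and at
all visited state-action pairs. -/
theorem runLaw_exists_event_deviation_le (K : ℕ) {L : ℝ} (hL : 0 < L) :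
    (G.runLaw β ε opp K).toOuterMeasure
      {l | l.length = K ∧ ∃ k ≤ K, ∃ h s a, ∃ U : Finset S,
        (episodeCount (l.take k)).visits h s a ≠ 0 ∧
        Real.sqrt (2 * L / (episodeCount (l.take k)).visits h s a) <
          ∑ s' ∈ U, (episodeCount (l.take k)).empirical h s a s'
            - ∑ s' ∈ U, (G.trans h s a s').toReal}
      ≤ ENNReal.ofReal ((K : ℝ) * K * H * Fintype.card S * Fintype.card (A × B)
          * 2 ^ Fintype.card S * Real.exp (-L)) := by
  -- The first index is the time and the second the visit count, both shifted by one. The count is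
  -- random but the best `t` depends on it, so each of its possible values gets its own
  -- supermartingale.
  set I := Fin K × Fin K × Fin H × S × (A × B) × Finset S
  set E : I → Set (List (Episode S A B H)) := fun i => {l | L ≤ prefixSum
    (fun _ e => visitExponent G i.2.2.1 i.2.2.2.1 i.2.2.2.2.1 i.2.2.2.2.2
      (Real.sqrt (2 * L / (((i.2.1 : ℕ) + 1 : ℕ) : ℝ))) e.traj) (l.take ((i.1 : ℕ) + 1))} with hE
  calc (G.runLaw β ε opp K).toOuterMeasure _
      ≤ (G.runLaw β ε opp K).toOuterMeasure (⋃ i, E i) := by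
        refine MeasureTheory.measure_mono fun l hl => ?_
        simp only [Set.mem_ofPred_eq] at hl
        obtain ⟨hlK, k, hk, h, s, a, U, hn, hdev⟩ := hl
        set n := (episodeCount (l.take k)).visits h s a with hndef
        have hnk : n ≤ k := (visits_episodeCount_le _ _ _ _).trans (by simp)
        have hn1 : 1 ≤ n := Nat.one_le_iff_ne_zero.2 hn
        refine Set.mem_iUnion.2 ⟨(⟨k - 1, by omega⟩, ⟨n - 1, by omega⟩, h, s, a, U), ?_⟩
        simp only [hE, Set.mem_ofPred_eq]
        rw [Nat.sub_add_cancel hn1, Nat.sub_add_cancel (hn1.trans hnk), prefixSum_visitExponent,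
          ← hndef]
        have hn0 : (0 : ℝ) < n := by exact_mod_cast hn1
        simp only [Counters.empirical, ← hndef, ne_eq, hn, not_false_eq_true, if_true,
          ← Finset.sum_div] at hdev
        set t := Real.sqrt (2 * L / n)
        have ht : 0 ≤ t := Real.sqrt_nonneg _
        have ht2 : t ^ 2 = 2 * L / n := Real.sq_sqrt (by positivity)
        have h1 : n * t ≤ ∑ s' ∈ U, (episodeCount (l.take k) h s a s' : ℝ)
            - n * ∑ s' ∈ U, (G.trans h s a s').toReal := by
          have := mul_le_mul_of_nonneg_left hdev.le hn0.le
          rwa [mul_sub, mul_div_cancel₀ _ hn0.ne'] at this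
        have h2 := mul_le_mul_of_nonneg_left h1 ht
        have h3 : t * (n * t) = 2 * L := by
          rw [show t * (n * t) = n * t ^ 2 by ring, ht2]
          field_simp
        have h4 : (n : ℝ) * (t ^ 2 / 2) = L := by
          rw [ht2]
          field_simp
        linarith
    _ ≤ ∑ i, (G.runLaw β ε opp K).toOuterMeasure (E i) :=
        MeasureTheory.measure_iUnion_fintype_le _ _
    _ ≤ ∑ _i : I, ENNReal.ofReal (Real.exp (-L)) :=
        Finset.sum_le_sum fun i _ => runLaw_visitExponent_tail G β ε opp _ _ _ _ _ (by omega) L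
    _ = _ := by
        rw [Finset.sum_const, nsmul_eq_mul, ← ENNReal.ofReal_natCast,
          ← ENNReal.ofReal_mul (Nat.cast_nonneg _)]
        congr 2
        simp only [I, Finset.card_univ, Fintype.card_prod, Fintype.card_fin, Fintype.card_finset]
        push_cast
        ring

end Fixed

end Run

/-! ### The grid in the simplex and its best responses. -/

section Cover

/-- Every point of the simplex is close in `ℓ¹` to a point with denominator `m`. -/
theorem exists_piAntidiag_near {X : Type*} {Ψ : Finset X} (hΨ : Ψ.Nonempty) {w : X → ℝ}
    (hw : ∀ x ∈ Ψ, 0 ≤ w x) (hw1 : ∑ x ∈ Ψ, w x = 1) {m : ℕ} (hm : 0 < m) :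
    ∃ j ∈ Finset.piAntidiag Ψ m, ∑ x ∈ Ψ, |w x - (j x : ℝ) / m| ≤ 2 * Ψ.card / m := by
  obtain ⟨x₀, hx₀⟩ := hΨ
  have hm0 : (0 : ℝ) < m := by exact_mod_cast hm
  set f : X → ℕ := fun x => ⌊m * w x⌋₊ with hf
  have hfl : ∀ x ∈ Ψ, (f x : ℝ) ≤ m * w x := fun x hx =>
    Nat.floor_le (mul_nonneg hm0.le (hw x hx))
  have hfu : ∀ x ∈ Ψ, m * w x ≤ f x + 1 := fun x _ => (Nat.lt_floor_add_one _).le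
  have hsum : ∑ x ∈ Ψ, (m : ℝ) * w x = m := by rw [← Finset.mul_sum, hw1, mul_one]
  have hle : ∑ x ∈ Ψ, f x ≤ m := by
    have : ∑ x ∈ Ψ, (f x : ℝ) ≤ m := (Finset.sum_le_sum hfl).trans_eq hsum
    exact_mod_cast this
  set d := m - ∑ x ∈ Ψ, f x with hd
  have hdR : (d : ℝ) = m - ∑ x ∈ Ψ, (f x : ℝ) := by
    rw [hd, Nat.cast_sub hle]
    push_cast
    rfl
  have hdle : (d : ℝ) ≤ Ψ.card := by
    have := Finset.sum_le_sum hfu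
    rw [hsum, Finset.sum_add_distrib, Finset.sum_const, nsmul_eq_mul, mul_one] at this
    linarith
  -- Round all coordinates down and give the missing mass `d ≤ |Ψ|` to `x₀`; the rounding and the
  -- correction each cost `d / m`.
  refine ⟨fun x => if x ∈ Ψ then f x + (if x = x₀ then d else 0) else 0, ?_, ?_⟩
  · rw [Finset.mem_piAntidiag]
    refine ⟨?_, fun x hx => ?_⟩
    · rw [Finset.sum_congr rfl fun x hx => if_pos hx, Finset.sum_add_distrib,
        Finset.sum_ite_eq' Ψ x₀, if_pos hx₀]
      omega
    · by_contra h
      simp [h] at hx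
  · calc _ ≤ ∑ x ∈ Ψ, ((m * w x - f x) / m + (if x = x₀ then (d : ℝ) else 0) / m) := by
          refine Finset.sum_le_sum fun x hx => ?_
          simp only [if_pos hx]
          rw [← add_div,
            show w x = m * w x / m by field_simp, ← sub_div, abs_div, abs_of_pos hm0,
            show (m : ℝ) * (m * w x / m) = m * w x by field_simp]
          refine div_le_div_of_nonneg_right ?_ hm0.le
          push_cast
          have h1 := hfl x hx
          have h2 : (0 : ℝ) ≤ if x = x₀ then (d : ℝ) else 0 := by split_ifs <;> positivity
          rw [abs_le]
          constructor <;> linarith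
      _ = 2 * d / m := by
          rw [Finset.sum_add_distrib, ← Finset.sum_div, ← Finset.sum_div, Finset.sum_sub_distrib,
            hsum, Finset.sum_ite_eq' Ψ x₀, if_pos hx₀, hdR]
          ring
      _ ≤ _ := by gcongr

theorem card_piAntidiag_le {X : Type*} (Ψ : Finset X) (m : ℕ) :
    (Finset.piAntidiag Ψ m).card ≤ (m + 1) ^ Ψ.card := by
  have : (Fintype.piFinset fun _ : Ψ => Finset.range (m + 1)).card = (m + 1) ^ Ψ.card := by
    simp
  rw [← this]
  refine Finset.card_le_card_of_injOn (fun j (x : Ψ) => j x) (fun j hj => ?_)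
    fun j hj j' hj' h => ?_
  · rw [Finset.mem_coe, Finset.mem_piAntidiag] at hj
    rw [Finset.mem_coe, Fintype.mem_piFinset]
    intro x
    have := Finset.single_le_sum (f := j) (fun _ _ => Nat.zero_le _) x.2
    rw [hj.1] at this
    exact Finset.mem_range.2 (Nat.lt_succ_of_le this)
  · rw [Finset.mem_coe, Finset.mem_piAntidiag] at hj hj'
    funext x
    by_cases hx : x ∈ Ψ
    · exact congrFun h ⟨x, hx⟩
    · have h1 : j x = 0 := by_contra fun h0 => hx (hj.2 x h0)
      have h2 : j' x = 0 := by_contra fun h0 => hx (hj'.2 x h0)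
      rw [h1, h2]

variable {S A B : Type*} {H : ℕ} [Fintype S] [Fintype A] [Fintype B]

theorem optMixValue_sub_le {r : Fin H → S → A × B → ℝ} {β : ℕ → ℝ} (hr : ∀ h s a, 0 ≤ r h s a)
    (hβ : ∀ n, 0 ≤ β n) (s₁ : S) (N : Counters S A B H) (Ψ : Finset (MinPolicy S A B H))
    (w w' : MinPolicy S A B H → ℝ) (μ : MaxPolicy S A B H) :
    optMixValue s₁ r β N Ψ w μ - optMixValue s₁ r β N Ψ w' μ ≤ H * ∑ ν ∈ Ψ, |w ν - w' ν| := by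
  rw [optMixValue, optMixValue, ← Finset.sum_sub_distrib, Finset.mul_sum]
  refine Finset.sum_le_sum fun ν _ => ?_
  have h := optValue_mem_Icc hr hβ s₁ N μ ν
  rw [← sub_mul]
  calc (w ν - w' ν) * optValue s₁ r β N μ ν ≤ |w ν - w' ν| * optValue s₁ r β N μ ν :=
        mul_le_mul_of_nonneg_right (le_abs_self _) h.1
    _ ≤ |w ν - w' ν| * H := mul_le_mul_of_nonneg_left h.2 (abs_nonneg _)
    _ = _ := mul_comm _ _

variable [Nonempty A]

theorem card_ucbBestResponse_le (s₁ : S) (r : Fin H → S → A × B → ℝ) (β : ℕ → ℝ) (ε : ℝ)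
    (N : Counters S A B H) (Ψ : Finset (MinPolicy S A B H)) :
    (ucbBestResponse s₁ r β ε N Ψ).card ≤ (⌈(Ψ.card : ℝ) / ε⌉₊ + 1) ^ Ψ.card :=
  Finset.card_image_le.trans (card_piAntidiag_le _ _)

/-- The policies in `UCB-BestResponse` are nearly as good as all policies against every sequence of
opponent policies from `Ψ`. -/
theorem exists_mem_ucbBestResponse {r : Fin H → S → A × B → ℝ} {β : ℕ → ℝ}
    (hr : ∀ h s a, 0 ≤ r h s a) (hβ : ∀ n, 0 ≤ β n) (s₁ : S) {ε : ℝ} (hε : 0 < ε)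
    (N : Counters S A B H) {Ψ : Finset (MinPolicy S A B H)} {ν : ℕ → MinPolicy S A B H} {n : ℕ}
    (hν : ∀ i < n, ν i ∈ Ψ) (μ : MaxPolicy S A B H) :
    ∃ μ' ∈ ucbBestResponse s₁ r β ε N Ψ,
      ∑ i ∈ Finset.range n, optValue s₁ r β N μ (ν i) ≤
        ∑ i ∈ Finset.range n, optValue s₁ r β N μ' (ν i) + 4 * H * ε * n := by
  rcases n.eq_zero_or_pos with rfl | hn
  · obtain ⟨μ', hμ'⟩ := ucbBestResponse_nonempty s₁ r β ε N Ψ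
    exact ⟨μ', hμ', by simp⟩
  have hn0 : (0 : ℝ) < n := by exact_mod_cast hn
  have hΨ : Ψ.Nonempty := ⟨ν 0, hν 0 hn⟩
  have hΨ0 : (0 : ℝ) < Ψ.card := by exact_mod_cast hΨ.card_pos
  set m : ℕ := ⌈(Ψ.card : ℝ) / ε⌉₊ with hm
  have hm0 : 0 < m := Nat.ceil_pos.2 (by positivity)
  have hmR : (0 : ℝ) < m := by exact_mod_cast hm0
  -- The total gain depends on the opponent's sequence only through its empirical frequencies, so a
  -- sequence amounts to one mixture `w`.
  set cnt : MinPolicy S A B H → ℕ := fun x => ((Finset.range n).filter fun i => ν i = x).card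
  have hmaps : ∀ i ∈ Finset.range n, ν i ∈ Ψ := fun i hi => hν i (Finset.mem_range.1 hi)
  have hcnt : ∀ f : MinPolicy S A B H → ℝ,
      ∑ i ∈ Finset.range n, f (ν i) = ∑ x ∈ Ψ, (cnt x : ℝ) * f x := by
    intro f
    rw [← Finset.sum_fiberwise_of_maps_to hmaps]
    refine Finset.sum_congr rfl fun x _ => ?_
    rw [Finset.sum_congr rfl fun i hi => by rw [(Finset.mem_filter.1 hi).2], Finset.sum_const,
      nsmul_eq_mul]
  set w : MinPolicy S A B H → ℝ := fun x => (cnt x : ℝ) / n with hw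
  have hw1 : ∑ x ∈ Ψ, w x = 1 := by
    have := hcnt fun _ => 1
    simp only [Finset.sum_const, Finset.card_range, nsmul_eq_mul, mul_one] at this
    rw [← Finset.sum_div, ← this, div_self hn0.ne']
  have hmix : ∀ μ, ∑ i ∈ Finset.range n, optValue s₁ r β N μ (ν i) =
      n * optMixValue s₁ r β N Ψ w μ := fun μ => by
    rw [hcnt, optMixValue, Finset.mul_sum]
    refine Finset.sum_congr rfl fun x _ => ?_
    simp only [hw]
    field_simp
  obtain ⟨j, hj, hjw⟩ := exists_piAntidiag_near hΨ (w := w) (fun x _ => by positivity) hw1 hm0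
  set v : MinPolicy S A B H → ℝ := fun x => (j x : ℝ) / m with hv
  have herr : ∑ x ∈ Ψ, |w x - v x| ≤ 2 * ε := by
    refine hjw.trans ?_
    rw [mul_div_assoc]
    refine mul_le_mul_of_nonneg_left ?_ zero_le_two
    have := Nat.le_ceil ((Ψ.card : ℝ) / ε)
    rw [← hm, div_le_iff₀ hε] at this
    rw [div_le_iff₀ hmR]
    linarith
  have herr' : ∑ x ∈ Ψ, |v x - w x| ≤ 2 * ε := by simpa only [abs_sub_comm] using herr
  refine ⟨optBestResponse s₁ r β N Ψ v, Finset.mem_image_of_mem _ hj, ?_⟩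
  have hbest : optMixValue s₁ r β N Ψ v μ
      ≤ optMixValue s₁ r β N Ψ v (optBestResponse s₁ r β N Ψ v) :=
    Classical.choose_spec (exists_max_optMixValue s₁ r β N Ψ v) μ
  have h1 := optMixValue_sub_le hr hβ s₁ N Ψ w v μ
  have h2 := optMixValue_sub_le hr hβ s₁ N Ψ v w (optBestResponse s₁ r β N Ψ v)
  have h3 := mul_le_mul_of_nonneg_left herr (Nat.cast_nonneg (α := ℝ) H)
  have h4 := mul_le_mul_of_nonneg_left herr' (Nat.cast_nonneg (α := ℝ) H)
  rw [hmix, hmix]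
  -- Pass from `w` to the grid point `v`, use optimality there, and return: two changes of weights,
  -- each costing `2 * H * ε`.
  have h5 : optMixValue s₁ r β N Ψ w μ
      ≤ optMixValue s₁ r β N Ψ w (optBestResponse s₁ r β N Ψ v) + 4 * H * ε := by linarith
  calc _ ≤ n * (optMixValue s₁ r β N Ψ w (optBestResponse s₁ r β N Ψ v) + 4 * H * ε) :=
        mul_le_mul_of_nonneg_left h5 hn0.le
    _ = _ := by ring

end Cover

/-! ### Evolution of the learner's memory and the number of restarts. -/

section Learner

variable {S A B : Type*} {H : ℕ} [Fintype S] [Fintype A] [Fintype B]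
  (s₁ : S) (r : Fin H → S → A × B → ℝ) (β : ℕ → ℝ) (ε : ℝ)

/-- EXP3 is restarted when the episode `e` is observed in the state `σ`. -/
def LearnerState.Restarts (σ : LearnerState S A B H) (e : Episode S A B H) : Prop :=
  e.opp ∉ σ.oppSet ∨ ∃ h s a,
    max 1 (2 * σ.lazyCount.visits h s a) ≤ (σ.count.record e.traj).visits h s a

/-- The mean optimistic value of the learner's random policy. -/
noncomputable def LearnerState.mixValue (σ : LearnerState S A B H) (ν : MinPolicy S A B H) : ℝ :=
  ∑ μ ∈ σ.polSet, (σ.play μ).toReal * optValue s₁ r β σ.lazyCount μ ν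

theorem LearnerState.mixValue_eq (σ : LearnerState S A B H) {Φ : Finset (MaxPolicy S A B H)}
    (hΦ : Φ.Nonempty) (h : σ.polSet = Φ) (ν : MinPolicy S A B H) :
    σ.mixValue s₁ r β ν = ∑ μ ∈ Φ, (expWeights Φ hΦ (fun μ =>
      Real.sqrt (Real.log Φ.card / (((σ.rounds : ℝ) + 1) * (H : ℝ) ^ 2)) * σ.gain μ) μ).toReal
        * optValue s₁ r β σ.lazyCount μ ν := by
  subst h
  rfl

variable [Nonempty A] (e : ℕ → Episode S A B H)

/-- The memory of adaptive OP-EXP3 after `t` episodes of the sequence `e`. -/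
noncomputable def stateAfter (t : ℕ) : LearnerState S A B H :=
  LearnerState.after s₁ r β ε ((List.range t).map e)

theorem stateAfter_succ (t : ℕ) :
    stateAfter s₁ r β ε e (t + 1) = (stateAfter s₁ r β ε e t).update s₁ r β ε (e t) := by
  simp [stateAfter, LearnerState.after, List.range_succ]

theorem stateAfter_succ_of_restarts {t : ℕ} (h : (stateAfter s₁ r β ε e t).Restarts (e t)) :
    stateAfter s₁ r β ε e (t + 1) = LearnerState.restart s₁ r β ε
      ((stateAfter s₁ r β ε e t).count.record (e t).traj)
      (insert (e t).opp (stateAfter s₁ r β ε e t).oppSet) := by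
  rw [stateAfter_succ]
  exact if_pos h

theorem stateAfter_succ_of_not_restarts {t : ℕ}
    (h : ¬ (stateAfter s₁ r β ε e t).Restarts (e t)) :
    stateAfter s₁ r β ε e (t + 1) =
      { stateAfter s₁ r β ε e t with
        count := (stateAfter s₁ r β ε e t).count.record (e t).traj
        rounds := (stateAfter s₁ r β ε e t).rounds + 1
        gain := fun μ => (stateAfter s₁ r β ε e t).gain μ
          + optValue s₁ r β (stateAfter s₁ r β ε e t).lazyCount μ (e t).opp } := by
  rw [stateAfter_succ]
  exact if_neg h

theorem count_stateAfter_succ (t : ℕ) : (stateAfter s₁ r β ε e (t + 1)).count =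
    (stateAfter s₁ r β ε e t).count.record (e t).traj := by
  by_cases h : (stateAfter s₁ r β ε e t).Restarts (e t)
  · rw [stateAfter_succ_of_restarts _ _ _ _ _ h]
    rfl
  · rw [stateAfter_succ_of_not_restarts _ _ _ _ _ h]

theorem count_stateAfter (t : ℕ) :
    (stateAfter s₁ r β ε e t).count = episodeCount ((List.range t).map e) := by
  induction t with
  | zero => rfl
  | succ t ih =>
    rw [count_stateAfter_succ, ih, List.range_succ, List.map_append, List.map_singleton,
      episodeCount_append]

/-- Lazy counters are true counters of an earlier time, so accuracy of all true counters carries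
over to them. -/
theorem exists_lazyCount_eq (t : ℕ) : ∃ s ≤ t,
    (stateAfter s₁ r β ε e t).lazyCount = episodeCount ((List.range s).map e) := by
  induction t with
  | zero => exact ⟨0, le_rfl, rfl⟩
  | succ t ih =>
    by_cases h : (stateAfter s₁ r β ε e t).Restarts (e t)
    · refine ⟨t + 1, le_rfl, ?_⟩
      rw [← count_stateAfter s₁ r β ε e, count_stateAfter_succ,
        stateAfter_succ_of_restarts _ _ _ _ _ h]
      rfl
    · obtain ⟨s, hs, h'⟩ := ih
      refine ⟨s, by omega, ?_⟩
      rw [stateAfter_succ_of_not_restarts _ _ _ _ _ h, ← h']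

theorem lazyCount_visits_le (t : ℕ) (h : Fin H) (s : S) (a : A × B) :
    (stateAfter s₁ r β ε e t).lazyCount.visits h s a ≤
      (stateAfter s₁ r β ε e t).count.visits h s a := by
  induction t with
  | zero => exact le_rfl
  | succ t ih =>
    by_cases hr : (stateAfter s₁ r β ε e t).Restarts (e t)
    · rw [stateAfter_succ_of_restarts _ _ _ _ _ hr]
      exact le_rfl
    · rw [count_stateAfter_succ, visits_record, stateAfter_succ_of_not_restarts _ _ _ _ _ hr]
      exact ih.trans (Nat.le_add_right _ _)

/-- After each update the doubling test fails: without a restart by definition, and after one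
because both counters agree. The `max` with 1 takes care of unvisited pairs. -/
theorem count_visits_lt (t : ℕ) (h : Fin H) (s : S) (a : A × B) :
    (stateAfter s₁ r β ε e t).count.visits h s a <
      max 1 (2 * (stateAfter s₁ r β ε e t).lazyCount.visits h s a) := by
  have key : ∀ n : ℕ, n < max 1 (2 * n) := fun n => by omega
  cases t with
  | zero => exact key _
  | succ t =>
    by_cases hr : (stateAfter s₁ r β ε e t).Restarts (e t)
    · rw [stateAfter_succ_of_restarts _ _ _ _ _ hr]
      exact key _
    · rw [stateAfter_succ_of_not_restarts _ _ _ _ _ hr]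
      by_contra hc
      exact hr (Or.inr ⟨h, s, a, not_lt.1 hc⟩)

theorem oppSet_stateAfter_subset {Ψ : Finset (MinPolicy S A B H)} {t : ℕ}
    (h : ∀ i < t, (e i).opp ∈ Ψ) : (stateAfter s₁ r β ε e t).oppSet ⊆ Ψ := by
  induction t with
  | zero => exact Finset.empty_subset _
  | succ t ih =>
    have ih' := ih fun i hi => h i (by omega)
    by_cases hr : (stateAfter s₁ r β ε e t).Restarts (e t)
    · rw [stateAfter_succ_of_restarts _ _ _ _ _ hr]
      exact Finset.insert_subset (h t (by omega)) ih'
    · rw [stateAfter_succ_of_not_restarts _ _ _ _ _ hr]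
      exact ih'

/-- Keeps the grid size polynomial in `K` even when `Ψ` has many more than `K` elements. -/
theorem card_oppSet_stateAfter_le (t : ℕ) : (stateAfter s₁ r β ε e t).oppSet.card ≤ t := by
  have : (stateAfter s₁ r β ε e t).oppSet ⊆ (Finset.range t).image fun i => (e i).opp :=
    oppSet_stateAfter_subset s₁ r β ε e fun i hi =>
      Finset.mem_image_of_mem _ (Finset.mem_range.2 hi)
  exact (Finset.card_le_card this).trans (Finset.card_image_le.trans (by simp))

/-- The number of restarts during the first `t` episodes. -/
noncomputable def restartCount (t : ℕ) : ℕ :=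
  ∑ i ∈ Finset.range t, if (stateAfter s₁ r β ε e i).Restarts (e i) then 1 else 0

/-- The binary length serves as an integer logarithm: doubling adds a digit, and a first visit
raises it from 0. -/
theorem size_lt_size_of_double {m n : ℕ} (h : max 1 (2 * m) ≤ n) : m.size + 1 ≤ n.size := by
  rw [Nat.add_one_le_iff, Nat.lt_size]
  rcases hk : m.size with _ | k
  · simpa using (le_max_left _ _).trans h
  · have h1 : 2 ^ k ≤ m := Nat.lt_size.1 (by omega)
    rw [pow_succ]
    have := (le_max_right _ _).trans h
    omega

/-- The right-hand side is a potential that never decreases. Each restart raises it by at least one,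
either through a new opponent policy or through a lazy counter that gains a binary digit. -/
theorem restartCount_le_potential (t : ℕ) : restartCount s₁ r β ε e t ≤
    (stateAfter s₁ r β ε e t).oppSet.card + ∑ p : Fin H × S × (A × B),
      ((stateAfter s₁ r β ε e t).lazyCount.visits p.1 p.2.1 p.2.2).size := by
  induction t with
  | zero => simp [restartCount]
  | succ t ih =>
    rw [restartCount, Finset.sum_range_succ, ← restartCount]
    by_cases hr : (stateAfter s₁ r β ε e t).Restarts (e t)
    · rw [if_pos hr, stateAfter_succ_of_restarts _ _ _ _ _ hr]
      set σ := stateAfter s₁ r β ε e t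
      simp only [LearnerState.restart]
      have hmono : ∀ p : Fin H × S × (A × B), (σ.lazyCount.visits p.1 p.2.1 p.2.2).size ≤
          ((σ.count.record (e t).traj).visits p.1 p.2.1 p.2.2).size := fun p => by
        refine Nat.size_le_size ((lazyCount_visits_le s₁ r β ε e t _ _ _).trans ?_)
        rw [visits_record]
        exact Nat.le_add_right _ _
      have hcard : σ.oppSet.card ≤ (insert (e t).opp σ.oppSet).card :=
        Finset.card_le_card (Finset.subset_insert _ _)
      have hsum := Finset.sum_le_sum fun p (_ : p ∈ Finset.univ) => hmono p
      rcases hr with hr | ⟨h, s, a, hd⟩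
      · rw [Finset.card_insert_of_notMem hr]
        omega
      · have : ∑ p : Fin H × S × (A × B), (σ.lazyCount.visits p.1 p.2.1 p.2.2).size <
            ∑ p : Fin H × S × (A × B),
              ((σ.count.record (e t).traj).visits p.1 p.2.1 p.2.2).size :=
          Finset.sum_lt_sum (fun p _ => hmono p)
            ⟨(h, s, a), Finset.mem_univ _, size_lt_size_of_double hd⟩
        omega
    · rw [if_neg hr, stateAfter_succ_of_not_restarts _ _ _ _ _ hr]
      exact ih

theorem restartCount_le {Ψ : Finset (MinPolicy S A B H)} {t : ℕ} (h : ∀ i < t, (e i).opp ∈ Ψ) :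
    restartCount s₁ r β ε e t ≤
      Ψ.card + H * Fintype.card S * Fintype.card (A × B) * t.size := by
  refine (restartCount_le_potential s₁ r β ε e t).trans
    (add_le_add (Finset.card_le_card (oppSet_stateAfter_subset s₁ r β ε e h)) ?_)
  calc _ ≤ ∑ p : Fin H × S × (A × B), t.size := by
        refine Finset.sum_le_sum fun p _ => Nat.size_le_size ?_
        obtain ⟨s, hs, hs'⟩ := exists_lazyCount_eq s₁ r β ε e t
        rw [hs']
        refine (visits_episodeCount_le _ _ _ _).trans ?_
        simpa using hs
    _ = _ := by
        simp only [Finset.sum_const, Finset.card_univ, Fintype.card_prod, Fintype.card_fin,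
          smul_eq_mul]
        ring

end Learner

/-! ### Runs of EXP3 between restarts, and sums of bonuses. -/

section Epochs

variable {S A B : Type*} {H : ℕ} [Fintype S] [Fintype A] [Fintype B] [Nonempty A]
  (s₁ : S) (r : Fin H → S → A × B → ℝ) (β : ℕ → ℝ) (ε : ℝ) (e : ℕ → Episode S A B H)

theorem polSet_stateAfter (t : ℕ) :
    (stateAfter s₁ r β ε e t).polSet = ucbBestResponse s₁ r β ε
      (stateAfter s₁ r β ε e t).lazyCount (stateAfter s₁ r β ε e t).oppSet := by
  induction t with
  | zero => rfl
  | succ t ih =>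
    by_cases h : (stateAfter s₁ r β ε e t).Restarts (e t)
    · rw [stateAfter_succ_of_restarts _ _ _ _ _ h]
      rfl
    · rw [stateAfter_succ_of_not_restarts _ _ _ _ _ h]
      exact ih

/-- At time `t`, the last restart of EXP3 was at time `s`. -/
structure LastRestart (t s : ℕ) : Prop where
  add_rounds : s + (stateAfter s₁ r β ε e t).rounds = t
  opp_mem : ∀ i < (stateAfter s₁ r β ε e t).rounds,
    (e (s + i)).opp ∈ (stateAfter s₁ r β ε e t).oppSet
  rounds_eq : ∀ i ≤ (stateAfter s₁ r β ε e t).rounds, (stateAfter s₁ r β ε e (s + i)).rounds = i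
  lazyCount_eq : ∀ i ≤ (stateAfter s₁ r β ε e t).rounds,
    (stateAfter s₁ r β ε e (s + i)).lazyCount = (stateAfter s₁ r β ε e t).lazyCount
  polSet_eq_polSet : ∀ i ≤ (stateAfter s₁ r β ε e t).rounds,
    (stateAfter s₁ r β ε e (s + i)).polSet = (stateAfter s₁ r β ε e t).polSet
  gain_eq : ∀ i ≤ (stateAfter s₁ r β ε e t).rounds, ∀ μ,
    (stateAfter s₁ r β ε e (s + i)).gain μ = ∑ j ∈ Finset.range i,
      optValue s₁ r β (stateAfter s₁ r β ε e t).lazyCount μ (e (s + j)).opp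

theorem lastRestart_of_fresh {t : ℕ} {N : Counters S A B H} {Ψ : Finset (MinPolicy S A B H)}
    (h : stateAfter s₁ r β ε e t = LearnerState.restart s₁ r β ε N Ψ) :
    LastRestart s₁ r β ε e t t := by
  have hr : (stateAfter s₁ r β ε e t).rounds = 0 := by rw [h]; rfl
  constructor
  · rw [hr]; rfl
  · intro i hi; omega
  · intro i hi
    obtain rfl : i = 0 := by omega
    exact hr
  · intro i hi
    obtain rfl : i = 0 := by omega
    rfl
  · intro i hi
    obtain rfl : i = 0 := by omega
    rfl
  · intro i hi μ
    obtain rfl : i = 0 := by omega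
    rw [add_zero, Finset.sum_range_zero]
    rw [h]
    rfl

theorem LastRestart.succ {t s : ℕ} (h : LastRestart s₁ r β ε e t s)
    (hr : ¬ (stateAfter s₁ r β ε e t).Restarts (e t)) : LastRestart s₁ r β ε e (t + 1) s := by
  have hs := stateAfter_succ_of_not_restarts s₁ r β ε e hr
  have hrd : (stateAfter s₁ r β ε e (t + 1)).rounds = (stateAfter s₁ r β ε e t).rounds + 1 := by
    rw [hs]
  have hlz : (stateAfter s₁ r β ε e (t + 1)).lazyCount = (stateAfter s₁ r β ε e t).lazyCount := by
    rw [hs]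
  have hpl : (stateAfter s₁ r β ε e (t + 1)).polSet = (stateAfter s₁ r β ε e t).polSet := by
    rw [hs]
  have hop : (stateAfter s₁ r β ε e (t + 1)).oppSet = (stateAfter s₁ r β ε e t).oppSet := by
    rw [hs]
  have hgn : ∀ μ, (stateAfter s₁ r β ε e (t + 1)).gain μ = (stateAfter s₁ r β ε e t).gain μ
      + optValue s₁ r β (stateAfter s₁ r β ε e t).lazyCount μ (e t).opp := fun μ => by
    rw [hs]
  have hadd := h.add_rounds
  have hlast : s + ((stateAfter s₁ r β ε e t).rounds + 1) = t + 1 := by omega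
  have hmem : (e t).opp ∈ (stateAfter s₁ r β ε e t).oppSet := by
    by_contra hc
    exact hr (Or.inl hc)
  constructor
  · rw [hrd, hlast]
  · intro i hi
    rw [hop]
    rw [hrd] at hi
    rcases Nat.lt_succ_iff_lt_or_eq.1 hi with hi | rfl
    · exact h.opp_mem i hi
    · rwa [hadd]
  · intro i hi
    rw [hrd] at hi
    rcases Nat.le_succ_iff.1 hi with hi | rfl
    · exact h.rounds_eq i hi
    · rw [Nat.succ_eq_add_one, hlast, hrd]
  · intro i hi
    rw [hrd] at hi
    rw [hlz]
    rcases Nat.le_succ_iff.1 hi with hi | rfl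
    · exact h.lazyCount_eq i hi
    · rw [Nat.succ_eq_add_one, hlast, hlz]
  · intro i hi
    rw [hrd] at hi
    rw [hpl]
    rcases Nat.le_succ_iff.1 hi with hi | rfl
    · exact h.polSet_eq_polSet i hi
    · rw [Nat.succ_eq_add_one, hlast, hpl]
  · intro i hi μ
    rw [hrd] at hi
    rw [hlz]
    rcases Nat.le_succ_iff.1 hi with hi | rfl
    · exact h.gain_eq i hi μ
    · have := h.gain_eq _ le_rfl μ
      rw [hadd] at this
      rw [Nat.succ_eq_add_one, hlast, hgn, Finset.sum_range_succ, hadd, this]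

variable {s₁ r β ε e}

/-- The optimistic regret in the current run of EXP3. -/
theorem LastRestart.regret_le {t s : ℕ} (h : LastRestart s₁ r β ε e t s)
    (hr : ∀ h s a, 0 ≤ r h s a) (hβ : ∀ n, 0 ≤ β n) (hε : 0 < ε) (hH : 0 < H) {Λ : ℝ}
    (hΛ : Real.log (stateAfter s₁ r β ε e t).polSet.card ≤ Λ) (μ : MaxPolicy S A B H) :
    ∑ i ∈ Finset.range (stateAfter s₁ r β ε e t).rounds,
      (optValue s₁ r β (stateAfter s₁ r β ε e (s + i)).lazyCount μ (e (s + i)).opp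
        - (stateAfter s₁ r β ε e (s + i)).mixValue s₁ r β (e (s + i)).opp)
      ≤ 3 * H * Real.sqrt ((stateAfter s₁ r β ε e t).rounds * Λ)
        + 4 * H * ε * (stateAfter s₁ r β ε e t).rounds := by
  have hH0 : (0 : ℝ) < H := by exact_mod_cast hH
  set σ := stateAfter s₁ r β ε e t with hσ
  -- In the current run no opponent policy was new, since it would have caused a restart; hence some
  -- policy of the fixed set `σ.polSet` competes with `μ`.
  obtain ⟨μ', hμ', hle⟩ := exists_mem_ucbBestResponse hr hβ s₁ hε σ.lazyCount
    (ν := fun i => (e (s + i)).opp) h.opp_mem μ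
  rw [← polSet_stateAfter] at hμ'
  have hedge := expWeights_regret_le σ.polSet_nonempty hH0
    (fun i μ => optValue s₁ r β σ.lazyCount μ (e (s + i)).opp)
    (fun i μ _ => optValue_mem_Icc hr hβ s₁ _ _ _) σ.rounds hμ'
  have hmix : ∀ i ∈ Finset.range σ.rounds,
      (optValue s₁ r β (stateAfter s₁ r β ε e (s + i)).lazyCount μ (e (s + i)).opp
        - (stateAfter s₁ r β ε e (s + i)).mixValue s₁ r β (e (s + i)).opp) =
      optValue s₁ r β σ.lazyCount μ (e (s + i)).opp - ∑ μ' ∈ σ.polSet,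
      (expWeights σ.polSet σ.polSet_nonempty (fun ν =>
        Real.sqrt (Real.log σ.polSet.card / (((i : ℝ) + 1) * (H : ℝ) ^ 2)) *
        ∑ j ∈ Finset.range i, optValue s₁ r β σ.lazyCount ν (e (s + j)).opp) μ').toReal
          * optValue s₁ r β σ.lazyCount μ' (e (s + i)).opp := by
    intro i hi
    have hi' := (Finset.mem_range.1 hi).le
    rw [LearnerState.mixValue_eq s₁ r β _ σ.polSet_nonempty (h.polSet_eq_polSet i hi'),
      h.lazyCount_eq i hi', h.rounds_eq i hi']
    simp only [h.gain_eq i hi']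
    rfl
  rw [Finset.sum_congr rfl hmix, Finset.sum_sub_distrib]
  have hmono : Real.sqrt (σ.rounds * Real.log σ.polSet.card) ≤ Real.sqrt (σ.rounds * Λ) :=
    Real.sqrt_le_sqrt (mul_le_mul_of_nonneg_left hΛ (Nat.cast_nonneg _))
  have := mul_le_mul_of_nonneg_left hmono (show 0 ≤ 3 * (H : ℝ) by positivity)
  linarith

/-- Cauchy–Schwarz for two terms; used at every restart to merge the finished run with the earlier
ones. -/
theorem sqrt_mul_add_sqrt_mul_le {a b x y : ℝ} (ha : 0 ≤ a) (hb : 0 ≤ b) (hx : 0 ≤ x)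
    (hy : 0 ≤ y) :
    Real.sqrt (a * x) + Real.sqrt (b * y) ≤ Real.sqrt ((a + b) * (x + y)) := by
  refine Real.le_sqrt_of_sq_le ?_
  have h1 := Real.sq_sqrt (mul_nonneg ha hx)
  have h2 := Real.sq_sqrt (mul_nonneg hb hy)
  have h3 : Real.sqrt (a * x) * Real.sqrt (b * y) = Real.sqrt (a * y) * Real.sqrt (b * x) := by
    rw [← Real.sqrt_mul (mul_nonneg ha hx), ← Real.sqrt_mul (mul_nonneg ha hy)]
    congr 1
    ring
  have h4 := Real.sq_sqrt (mul_nonneg ha hy)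
  have h5 := Real.sq_sqrt (mul_nonneg hb hx)
  nlinarith [sq_nonneg (Real.sqrt (a * y) - Real.sqrt (b * x))]

/-- The optimistic regret over all episodes that do not trigger a restart. -/
theorem sum_not_restarts_regret_le (hr : ∀ h s a, 0 ≤ r h s a) (hβ : ∀ n, 0 ≤ β n) (hε : 0 < ε)
    (hH : 0 < H) {Λ : ℝ} {k : ℕ}
    (hΛ : ∀ t ≤ k, Real.log (stateAfter s₁ r β ε e t).polSet.card ≤ Λ) (μ : MaxPolicy S A B H) :
    ∑ i ∈ Finset.range k, (if (stateAfter s₁ r β ε e i).Restarts (e i) then 0 else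
      (optValue s₁ r β (stateAfter s₁ r β ε e i).lazyCount μ (e i).opp
        - (stateAfter s₁ r β ε e i).mixValue s₁ r β (e i).opp))
      ≤ 3 * H * Real.sqrt Λ * Real.sqrt (((restartCount s₁ r β ε e k : ℝ) + 1) * k)
        + 4 * H * ε * k := by
  have hΛ0 : 0 ≤ Λ := (Real.log_natCast_nonneg _).trans (hΛ 0 (Nat.zero_le _))
  have hcur : ∀ t ≤ k, ∀ s, LastRestart s₁ r β ε e t s →
      ∑ i ∈ Finset.range (stateAfter s₁ r β ε e t).rounds,
      (optValue s₁ r β (stateAfter s₁ r β ε e (s + i)).lazyCount μ (e (s + i)).opp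
        - (stateAfter s₁ r β ε e (s + i)).mixValue s₁ r β (e (s + i)).opp)
      ≤ 3 * H * Real.sqrt Λ * Real.sqrt (1 * (stateAfter s₁ r β ε e t).rounds)
        + 4 * H * ε * (stateAfter s₁ r β ε e t).rounds := fun t ht s h => by
    have := h.regret_le hr hβ hε hH (hΛ t ht) μ
    rw [one_mul]
    rwa [mul_comm _ Λ, Real.sqrt_mul hΛ0, ← mul_assoc] at this
  -- Only finished runs are bounded; the sum over the current run is kept exact, because its bound
  -- as a function of the length is not additive.
  have main : ∀ t ≤ k, ∃ s, LastRestart s₁ r β ε e t s ∧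
      ∑ i ∈ Finset.range t, (if (stateAfter s₁ r β ε e i).Restarts (e i) then 0 else
      (optValue s₁ r β (stateAfter s₁ r β ε e i).lazyCount μ (e i).opp
        - (stateAfter s₁ r β ε e i).mixValue s₁ r β (e i).opp))
      ≤ 3 * H * Real.sqrt Λ * Real.sqrt ((restartCount s₁ r β ε e t : ℝ) * s) + 4 * H * ε * s
        + ∑ i ∈ Finset.range (stateAfter s₁ r β ε e t).rounds,
      (optValue s₁ r β (stateAfter s₁ r β ε e (s + i)).lazyCount μ (e (s + i)).opp
        - (stateAfter s₁ r β ε e (s + i)).mixValue s₁ r β (e (s + i)).opp) := by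
    intro t ht
    induction t with
    | zero => exact ⟨0, lastRestart_of_fresh s₁ r β ε e rfl, by simp [stateAfter,
        LearnerState.after, LearnerState.restart]⟩
    | succ t ih =>
      obtain ⟨s, hs, hle⟩ := ih (by omega)
      rw [Finset.sum_range_succ]
      by_cases h : (stateAfter s₁ r β ε e t).Restarts (e t)
      · have hnew := stateAfter_succ_of_restarts s₁ r β ε e h
        refine ⟨t + 1, lastRestart_of_fresh s₁ r β ε e hnew, ?_⟩
        have hcount : restartCount s₁ r β ε e (t + 1) = restartCount s₁ r β ε e t + 1 := by
          rw [restartCount, Finset.sum_range_succ, if_pos h, ← restartCount]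
        have hrd : (stateAfter s₁ r β ε e (t + 1)).rounds = 0 := by rw [hnew]; rfl
        rw [if_pos h, add_zero, hrd, Finset.sum_range_zero, add_zero, hcount]
        have hadd : (s : ℝ) + (stateAfter s₁ r β ε e t).rounds = t := by
          exact_mod_cast hs.add_rounds
        have hc := hcur t (by omega) s hs
        have hsq := sqrt_mul_add_sqrt_mul_le
          (Nat.cast_nonneg (α := ℝ) (restartCount s₁ r β ε e t)) zero_le_one
          (Nat.cast_nonneg (α := ℝ) s)
          (Nat.cast_nonneg (α := ℝ) (stateAfter s₁ r β ε e t).rounds)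
        rw [hadd] at hsq
        have hsq' : Real.sqrt (((restartCount s₁ r β ε e t : ℝ) + 1) * t) ≤
            Real.sqrt (((restartCount s₁ r β ε e t : ℝ) + 1) * ((t : ℝ) + 1)) :=
          Real.sqrt_le_sqrt (mul_le_mul_of_nonneg_left (by linarith) (by positivity))
        have hm := mul_le_mul_of_nonneg_left (hsq.trans hsq')
          (show 0 ≤ 3 * H * Real.sqrt Λ by positivity)
        have he : 0 ≤ 4 * H * ε := by positivity
        push_cast
        have hadd' : 4 * H * ε * (t : ℝ) = 4 * H * ε * s
            + 4 * H * ε * (stateAfter s₁ r β ε e t).rounds := by rw [← hadd]; ring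
        linarith
      · refine ⟨s, hs.succ _ _ _ _ _ h, ?_⟩
        have hcount : restartCount s₁ r β ε e (t + 1) = restartCount s₁ r β ε e t := by
          rw [restartCount, Finset.sum_range_succ, if_neg h, ← restartCount, add_zero]
        have hrd : (stateAfter s₁ r β ε e (t + 1)).rounds =
            (stateAfter s₁ r β ε e t).rounds + 1 := by
          rw [stateAfter_succ_of_not_restarts s₁ r β ε e h]
        rw [if_neg h, hcount, hrd, Finset.sum_range_succ, hs.add_rounds]
        linarith
  obtain ⟨s, hs, hle⟩ := main k le_rfl
  have hadd : (s : ℝ) + (stateAfter s₁ r β ε e k).rounds = k := by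
    exact_mod_cast hs.add_rounds
  have hc := hcur k le_rfl s hs
  have hsq := sqrt_mul_add_sqrt_mul_le
    (Nat.cast_nonneg (α := ℝ) (restartCount s₁ r β ε e k)) zero_le_one
    (Nat.cast_nonneg (α := ℝ) s)
    (Nat.cast_nonneg (α := ℝ) (stateAfter s₁ r β ε e k).rounds)
  rw [hadd] at hsq
  have hm := mul_le_mul_of_nonneg_left hsq (show 0 ≤ 3 * H * Real.sqrt Λ by positivity)
  have hadd' : 4 * H * ε * (k : ℝ) = 4 * H * ε * s
      + 4 * H * ε * (stateAfter s₁ r β ε e k).rounds := by rw [← hadd]; ring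
  linarith

/-- In each episode exactly one pair per step gains a visit, and the growth of its `2 * √visits`
pays for the summand. -/
theorem sum_inv_sqrt_visits_le_potential (t : ℕ) :
    ∑ i ∈ Finset.range t, ∑ h : Fin H, 1 / Real.sqrt (((stateAfter s₁ r β ε e i).count.visits h
        ((e i).traj.1 h).1 ((e i).traj.1 h).2 : ℝ) + 1)
      ≤ ∑ h : Fin H, ∑ p : S × (A × B),
        2 * Real.sqrt ((stateAfter s₁ r β ε e t).count.visits h p.1 p.2) := by
  induction t with
  | zero =>
    rw [Finset.sum_range_zero]
    exact Finset.sum_nonneg fun h _ => Finset.sum_nonneg fun p _ => by positivity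
  | succ t ih =>
    rw [Finset.sum_range_succ]
    refine (add_le_add_left ih _).trans ?_
    rw [← Finset.sum_add_distrib]
    refine Finset.sum_le_sum fun h _ => ?_
    set N := (stateAfter s₁ r β ε e t).count with hN
    have hstep : ∀ p : S × (A × B), 2 * Real.sqrt (N.visits h p.1 p.2)
        + (if p = (e t).traj.1 h then 1 / Real.sqrt ((N.visits h p.1 p.2 : ℝ) + 1) else 0)
        ≤ 2 * Real.sqrt ((stateAfter s₁ r β ε e (t + 1)).count.visits h p.1 p.2) := by
      intro p
      rw [count_stateAfter_succ, visits_record, ← hN]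
      by_cases hp : p = (e t).traj.1 h
      · rw [if_pos hp, if_pos (by rw [← hp])]
        have := one_div_sqrt_succ_le (N.visits h p.1 p.2)
        push_cast
        linarith
      · rw [if_neg hp, if_neg fun hc => hp (by rw [hc])]
        simp
    refine le_trans (le_of_eq ?_) (Finset.sum_le_sum fun p _ => hstep p)
    rw [Finset.sum_add_distrib, Finset.sum_ite_eq' Finset.univ, if_pos (Finset.mem_univ _)]

/-- At each step the visits of all pairs add up to `t`, so Cauchy–Schwarz over the pairs bounds the
sum of the square roots. -/
theorem sum_inv_sqrt_visits_le (t : ℕ) :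
    ∑ i ∈ Finset.range t, ∑ h : Fin H, 1 / Real.sqrt (((stateAfter s₁ r β ε e i).count.visits h
        ((e i).traj.1 h).1 ((e i).traj.1 h).2 : ℝ) + 1)
      ≤ 2 * H * Real.sqrt (Fintype.card S * Fintype.card (A × B) * t) := by
  refine sum_inv_sqrt_visits_le_potential t |>.trans ?_
  calc _ ≤ ∑ h : Fin H, 2 * Real.sqrt (Fintype.card S * Fintype.card (A × B) * t) := by
        refine Finset.sum_le_sum fun h _ => ?_
        rw [← Finset.mul_sum]
        refine mul_le_mul_of_nonneg_left (Real.le_sqrt_of_sq_le ?_) zero_le_two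
        refine (sq_sum_le_card_mul_sum_sq).trans_eq ?_
        simp only [Real.sq_sqrt (Nat.cast_nonneg _)]
        rw [count_stateAfter, ← Nat.cast_sum, sum_visits_episodeCount]
        simp only [Finset.card_univ, Fintype.card_prod, List.length_map, List.length_range]
        push_cast
        ring
    _ = _ := by
        rw [Finset.sum_const, Finset.card_univ, Fintype.card_fin, nsmul_eq_mul]
        ring

/-- The bonuses at the lazy counters are comparable to those at the latest counters. -/
theorem one_div_sqrt_lazy_le (t : ℕ) (h : Fin H) (s : S) (a : A × B) :
    1 / Real.sqrt (max ((stateAfter s₁ r β ε e t).lazyCount.visits h s a : ℝ) 1) ≤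
      2 * (1 / Real.sqrt (((stateAfter s₁ r β ε e t).count.visits h s a : ℝ) + 1)) := by
  have hlt := count_visits_lt s₁ r β ε e t h s a
  set n := (stateAfter s₁ r β ε e t).lazyCount.visits h s a
  set N := (stateAfter s₁ r β ε e t).count.visits h s a
  -- The failed doubling test gives the factor 2; 4 is a perfect square and makes the root clean.
  have h1 : ((N : ℝ) + 1) ≤ 4 * max (n : ℝ) 1 := by
    have : N + 1 ≤ 2 * max n 1 := by omega
    have h2 : ((N : ℝ) + 1) ≤ 2 * max (n : ℝ) 1 := by exact_mod_cast this
    have h3 : (1 : ℝ) ≤ max (n : ℝ) 1 := le_max_right _ _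
    linarith
  have h2 := Real.sqrt_le_sqrt h1
  rw [Real.sqrt_mul (by norm_num), show (4 : ℝ) = 2 ^ 2 by norm_num,
    Real.sqrt_sq zero_le_two] at h2
  have hp1 : 0 < Real.sqrt ((N : ℝ) + 1) := Real.sqrt_pos.2 (by positivity)
  have hp2 : 0 < Real.sqrt (max (n : ℝ) 1) :=
    Real.sqrt_pos.2 (lt_of_lt_of_le one_pos (le_max_right _ _))
  rw [mul_one_div, div_le_div_iff₀ hp2 hp1]
  linarith

end Epochs

/-! ### Decomposition of the regret. -/

section Regret

theorem sum_map_range {M : Type*} [AddCommMonoid M] (f : ℕ → M) (n : ℕ) :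
    ((List.range n).map f).sum = ∑ i ∈ Finset.range n, f i := by
  induction n with
  | zero => simp
  | succ n ih => simp [List.range_succ, Finset.sum_range_succ, ih]

variable {S A B : Type*} {H : ℕ} [Fintype S] [Fintype A] [Fintype B]

theorem mixValue_mem_Icc {G : MarkovGame S A B H} {β : ℕ → ℝ} (hβ : ∀ n, 0 ≤ β n)
    (σ : LearnerState S A B H) (ν : MinPolicy S A B H) :
    σ.mixValue G.start G.reward β ν ∈ Set.Icc (0 : ℝ) H := by
  have h := fun μ => optValue_mem_Icc (fun h s a => (G.reward_mem h s a).1) hβ G.start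
    σ.lazyCount μ ν
  refine ⟨Finset.sum_nonneg fun μ _ => mul_nonneg ENNReal.toReal_nonneg (h μ).1, ?_⟩
  calc σ.mixValue G.start G.reward β ν ≤ ∑ μ ∈ σ.polSet, (σ.play μ).toReal * H :=
        Finset.sum_le_sum fun μ _ => mul_le_mul_of_nonneg_left (h μ).2 ENNReal.toReal_nonneg
    _ = H := by
        rw [← Finset.sum_mul, LearnerState.play, sum_expWeights_toReal, one_mul]

variable [Nonempty A]

/-- Twice the bonuses that the learner uses in the state `σ`. -/
def LearnerState.doubleBonus (β : ℕ → ℝ) (σ : LearnerState S A B H) (h : Fin H) (s : S)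
    (a : A × B) : ℝ := 2 * β (σ.lazyCount.visits h s a)

/-- The deviation of the optimistic value from its mean over the random choice of the learner. -/
noncomputable def policyNoise (G : MarkovGame S A B H) (β : ℕ → ℝ) (ε : ℝ)
    (l : List (Episode S A B H)) (e : Episode S A B H) : ℝ :=
  (LearnerState.after G.start G.reward β ε l).mixValue G.start G.reward β e.opp -
    optValue G.start G.reward β (LearnerState.after G.start G.reward β ε l).lazyCount e.pol e.opp

/-- The deviation of the realized sum of the bonuses from its mean. -/
noncomputable def bonusNoise (G : MarkovGame S A B H) (β : ℕ → ℝ) (ε : ℝ)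
    (l : List (Episode S A B H)) (e : Episode S A B H) : ℝ :=
  finMean (G.trajLaw e.pol e.opp H le_rfl)
      (trajSum ((LearnerState.after G.start G.reward β ε l).doubleBonus β) le_rfl) -
    trajSum ((LearnerState.after G.start G.reward β ε l).doubleBonus β) le_rfl e.traj

variable {G : MarkovGame S A B H} {β : ℕ → ℝ} {ε : ℝ} {e : ℕ → Episode S A B H}

theorem sum_trajSum_doubleBonus_le {b : ℝ} (hb : 0 ≤ b)
    (hβ : ∀ n, β n = b * (1 / Real.sqrt (max (n : ℝ) 1))) (k : ℕ) :
    ∑ t ∈ Finset.range k,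
      trajSum ((stateAfter G.start G.reward β ε e t).doubleBonus β) le_rfl (e t).traj
      ≤ 8 * b * H * Real.sqrt (Fintype.card S * Fintype.card (A × B) * k) := by
  calc _ ≤ ∑ t ∈ Finset.range k, ∑ h : Fin H, 4 * b *
        (1 / Real.sqrt (((stateAfter G.start G.reward β ε e t).count.visits h
          ((e t).traj.1 h).1 ((e t).traj.1 h).2 : ℝ) + 1)) := by
        refine Finset.sum_le_sum fun t _ => Finset.sum_le_sum fun h _ => ?_
        simp only [LearnerState.doubleBonus, hβ]
        have := mul_le_mul_of_nonneg_left (one_div_sqrt_lazy_le (s₁ := G.start) (r := G.reward)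
          (β := β) (ε := ε) (e := e) t h ((e t).traj.1 h).1 ((e t).traj.1 h).2) hb
        have e' : Fin.castLE le_rfl h = h := rfl
        rw [e']
        linarith
    _ = 4 * b * ∑ t ∈ Finset.range k, ∑ h : Fin H,
        (1 / Real.sqrt (((stateAfter G.start G.reward β ε e t).count.visits h
          ((e t).traj.1 h).1 ((e t).traj.1 h).2 : ℝ) + 1)) := by
        simp only [Finset.mul_sum]
    _ ≤ 4 * b * (2 * H * Real.sqrt (Fintype.card S * Fintype.card (A × B) * k)) :=
        mul_le_mul_of_nonneg_left (sum_inv_sqrt_visits_le k) (by positivity)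
    _ = _ := by ring

/-- The regret of adaptive OP-EXP3 along a sequence of episodes with accurate counters. -/
theorem regret_le_of_accurate {b : ℝ} (hb : 0 ≤ b)
    (hβ : ∀ n, β n = b * (1 / Real.sqrt (max (n : ℝ) 1))) (hε : 0 < ε) (hH : 0 < H) {Λ : ℝ}
    {k : ℕ} (hΛ : ∀ t ≤ k, Real.log (stateAfter G.start G.reward β ε e t).polSet.card ≤ Λ)
    (hacc : ∀ t ≤ k, G.Accurate β (episodeCount ((List.range t).map e))) :
    G.regret ((List.range k).map e) ≤
      3 * H * Real.sqrt Λ *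
        Real.sqrt (((restartCount G.start G.reward β ε e k : ℝ) + 1) * k) + 4 * H * ε * k
      + prefixSum (policyNoise G β ε) ((List.range k).map e)
      + prefixSum (bonusNoise G β ε) ((List.range k).map e)
      + 8 * b * H * Real.sqrt (Fintype.card S * Fintype.card (A × B) * k)
      + 2 * H * restartCount G.start G.reward β ε e k := by
  have hβ0 : ∀ n, 0 ≤ β n := fun n => by rw [hβ]; positivity
  have hr : ∀ h s a, 0 ≤ G.reward h s a := fun h s a => (G.reward_mem h s a).1
  have : Nonempty (MaxPolicy S A B H) := ⟨(e 0).pol⟩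
  refine ciSup_le fun μ => ?_
  rw [List.map_map, sum_map_range, prefixSum_range, prefixSum_range]
  set σ := stateAfter G.start G.reward β ε e with hσ
  have hlazy : ∀ t < k, G.Accurate β (σ t).lazyCount := fun t ht => by
    obtain ⟨s, hs, h⟩ := exists_lazyCount_eq G.start G.reward β ε e t
    rw [hσ, h]
    exact hacc s (by omega)
  -- The decomposition for one episode. Restart episodes are left out of the EXP3 sum and charged `2
  -- * H` instead.
  have hpoint : ∀ t ∈ Finset.range k,
      ((fun e => G.value μ e.opp - G.value e.pol e.opp) ∘ e) t ≤
      (if (σ t).Restarts (e t) then 0 else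
        (optValue G.start G.reward β (σ t).lazyCount μ (e t).opp
          - (σ t).mixValue G.start G.reward β (e t).opp))
      + policyNoise G β ε ((List.range t).map e) (e t)
      + bonusNoise G β ε ((List.range t).map e) (e t)
      + trajSum ((σ t).doubleBonus β) le_rfl (e t).traj
      + 2 * H * (if (σ t).Restarts (e t) then 1 else 0 : ℕ) := by
    intro t ht
    have hN := hlazy t (Finset.mem_range.1 ht)
    have h1 := hN.value_le_optValue hβ0 μ (e t).opp
    have h2 : optValue G.start G.reward β (σ t).lazyCount (e t).pol (e t).opp ≤
        G.value (e t).pol (e t).opp + finMean (G.trajLaw (e t).pol (e t).opp H le_rfl)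
          (trajSum ((σ t).doubleBonus β) le_rfl) := hN.optValue_le hβ0 _ _
    have e1 : policyNoise G β ε ((List.range t).map e) (e t) =
        (σ t).mixValue G.start G.reward β (e t).opp -
          optValue G.start G.reward β (σ t).lazyCount (e t).pol (e t).opp := rfl
    have e2 : bonusNoise G β ε ((List.range t).map e) (e t) =
        finMean (G.trajLaw (e t).pol (e t).opp H le_rfl)
          (trajSum ((σ t).doubleBonus β) le_rfl) -
        trajSum ((σ t).doubleBonus β) le_rfl (e t).traj := rfl
    rw [e1, e2, Function.comp_apply]
    split_ifs with h
    -- One `H` bounds the true regret of the episode; the other compensates for `policyNoise`, which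
    -- stays in the sum and may be as low as `-H`.
    · have h3 := (value_mem_Icc G μ (e t).opp).2
      have h4 := (value_mem_Icc G (e t).pol (e t).opp).1
      have h5 := (mixValue_mem_Icc (G := G) hβ0 (σ t) (e t).opp).1
      have h6 := (optValue_mem_Icc hr hβ0 G.start (σ t).lazyCount (e t).pol (e t).opp).2
      have h7 : 0 ≤ finMean (G.trajLaw (e t).pol (e t).opp H le_rfl)
          (trajSum ((σ t).doubleBonus β) le_rfl) :=
        Finset.sum_nonneg fun x _ => mul_nonneg ENNReal.toReal_nonneg
          (Finset.sum_nonneg fun i _ => mul_nonneg zero_le_two (hβ0 _))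
      push_cast
      linarith
    · push_cast
      linarith
  refine (Finset.sum_le_sum hpoint).trans ?_
  rw [Finset.sum_add_distrib, Finset.sum_add_distrib, Finset.sum_add_distrib,
    Finset.sum_add_distrib, ← Finset.mul_sum, ← Nat.cast_sum, ← restartCount]
  have h1 := sum_not_restarts_regret_le hr hβ0 hε hH hΛ μ
  have h2 := sum_trajSum_doubleBonus_le (G := G) (ε := ε) (e := e) hb hβ k
  linarith

end Regret

/-! ### Concentration of the two noise terms. -/

section Noise

variable {S A B : Type*} {H : ℕ} [Fintype S] [Fintype A] [Fintype B] [Nonempty A]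
  (G : MarkovGame S A B H) {β : ℕ → ℝ} (ε : ℝ)
  (opp : List (Episode S A B H) → PMF (MinPolicy S A B H))

theorem support_expWeights_subset {X : Type*} (Φ : Finset X) (hΦ : Φ.Nonempty) (g : X → ℝ) :
    (expWeights Φ hΦ g).support ⊆ ↑Φ := by
  intro x hx
  by_contra hc
  exact ((PMF.mem_support_iff _ _).1 hx)
    (PMF.ofFinset_apply_of_notMem (h := _) (h' := _) (by simpa using hc))

/-- For fixed `ν` the noise is centred under `σ.play`, because `σ` is determined by the past. The
noise is mean minus value, hence the sign change of `t`. -/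
theorem pmfMean_exp_policyNoise_le (hβ : ∀ n, 0 ≤ β n) (hH : 0 < H) (t : ℝ)
    (l : List (Episode S A B H)) :
    pmfMean (G.stepLaw β ε opp l)
        (fun e => ENNReal.ofReal (Real.exp (t * policyNoise G β ε l e)))
      ≤ ENNReal.ofReal (Real.exp (t ^ 2 * (H : ℝ) ^ 2 / 2)) := by
  have hr : ∀ h s a, 0 ≤ G.reward h s a := fun h s a => (G.reward_mem h s a).1
  rw [pmfMean_stepLaw]
  refine pmfMean_le fun ν _ => ?_
  simp only [pmfMean_const, policyNoise]
  set σ := LearnerState.after G.start G.reward β ε l with hσ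
  rw [pmfMean_ofReal (p := σ.play) (s := σ.polSet) (support_expWeights_subset _ _ _)
    fun _ _ => (Real.exp_pos _).le]
  refine ENNReal.ofReal_le_ofReal ?_
  have := sum_mul_exp_sub_mean_le (-t) (by exact_mod_cast hH) (s := σ.polSet)
    (w := fun μ => (σ.play μ).toReal)
    (x := fun μ => optValue G.start G.reward β σ.lazyCount μ ν)
    (fun _ _ => ENNReal.toReal_nonneg) (sum_expWeights_toReal _ _)
    (fun μ _ => optValue_mem_Icc hr hβ G.start σ.lazyCount μ ν)
  rw [neg_sq] at this
  refine le_trans (le_of_eq ?_) this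
  refine Finset.sum_congr rfl fun μ _ => ?_
  rw [show ∀ u v : ℝ, -t * (u - v) = t * (v - u) from fun u v => by ring]
  rfl

/-- Given the past and both policies, the bonus function is fixed and the trajectory is fresh. Its
`H` steps contribute at most `2 * b` each. -/
theorem pmfMean_exp_bonusNoise_le {b : ℝ} (hβ : ∀ n, β n ∈ Set.Icc 0 b) (hb : 0 < b) (hH : 0 < H)
    (t : ℝ) (l : List (Episode S A B H)) :
    pmfMean (G.stepLaw β ε opp l)
        (fun e => ENNReal.ofReal (Real.exp (t * bonusNoise G β ε l e)))
      ≤ ENNReal.ofReal (Real.exp (t ^ 2 * (2 * b * H) ^ 2 / 2)) := by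
  have hH0 : (0 : ℝ) < H := by exact_mod_cast hH
  rw [pmfMean_stepLaw]
  refine pmfMean_le fun ν _ => pmfMean_le fun μ _ => ?_
  refine pmfMean_exp_mul_mean_sub_le _ (by positivity) (fun x => ⟨?_, ?_⟩) t
  · exact Finset.sum_nonneg fun i _ => mul_nonneg zero_le_two (hβ _).1
  · refine (Finset.sum_le_sum fun i _ =>
      mul_le_mul_of_nonneg_left (hβ _).2 zero_le_two).trans_eq ?_
    rw [Finset.sum_const, Finset.card_univ, Fintype.card_fin, nsmul_eq_mul]
    ring

/-- The noise terms are uniformly small with high probability. -/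
theorem runLaw_exists_noise_le {D : List (Episode S A B H) → Episode S A B H → ℝ} {B' : ℝ}
    (hB : 0 < B')
    (hD : ∀ t l, pmfMean (G.stepLaw β ε opp l)
        (fun e => ENNReal.ofReal (Real.exp (t * D l e)))
      ≤ ENNReal.ofReal (Real.exp (t ^ 2 * B' ^ 2 / 2))) (K : ℕ) {L : ℝ} (hL : 0 ≤ L) :
    (G.runLaw β ε opp K).toOuterMeasure
      {l | l.length = K ∧ ∃ k, 1 ≤ k ∧ k ≤ K ∧
        B' * Real.sqrt (2 * k * L) ≤ prefixSum D (l.take k)}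
      ≤ ENNReal.ofReal (K * Real.exp (-L)) := by
  rw [runLaw_eq_sequenceLaw]
  set E : Fin K → Set (List (Episode S A B H)) := fun i => {l | l.length = K ∧
    B' * Real.sqrt (2 * (((i : ℕ) + 1 : ℕ) : ℝ) * L) ≤ prefixSum D (l.take ((i : ℕ) + 1))} with hE
  calc _ ≤ (sequenceLaw (G.stepLaw β ε opp) K).toOuterMeasure (⋃ i, E i) := by
        refine MeasureTheory.measure_mono fun l hl => ?_
        simp only [Set.mem_ofPred_eq] at hl
        obtain ⟨hlK, k, hk1, hk, h⟩ := hl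
        refine Set.mem_iUnion.2 ⟨⟨k - 1, by omega⟩, ?_⟩
        simp only [hE, Set.mem_ofPred_eq]
        rw [Nat.sub_add_cancel hk1]
        exact ⟨hlK, h⟩
    _ ≤ ∑ i, (sequenceLaw (G.stepLaw β ε opp) K).toOuterMeasure (E i) :=
        MeasureTheory.measure_iUnion_fintype_le _ _
    _ ≤ ∑ _i : Fin K, ENNReal.ofReal (Real.exp (-L)) :=
        Finset.sum_le_sum fun i _ =>
          sequenceLaw_azuma hB hD (by omega) (by omega) hL
    _ = _ := by
        rw [Finset.sum_const, nsmul_eq_mul, ← ENNReal.ofReal_natCast,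
          ← ENNReal.ofReal_mul (Nat.cast_nonneg _), Finset.card_univ, Fintype.card_fin]

end Noise

/-! ### Combination of the failure events, and numerical estimates. -/

theorem ofReal_one_sub_le_toOuterMeasure {X : Type*} (p : PMF X) {s b₁ b₂ b₃ : Set X}
    {δ₁ δ₂ δ₃ δ : ℝ} (h₁ : p.toOuterMeasure b₁ ≤ ENNReal.ofReal δ₁)
    (h₂ : p.toOuterMeasure b₂ ≤ ENNReal.ofReal δ₂) (h₃ : p.toOuterMeasure b₃ ≤ ENNReal.ofReal δ₃)
    (n₁ : 0 ≤ δ₁) (n₂ : 0 ≤ δ₂) (n₃ : 0 ≤ δ₃) (hδ : δ₁ + δ₂ + δ₃ ≤ δ)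
    (hs : ∀ x ∈ p.support, x ∉ b₁ → x ∉ b₂ → x ∉ b₃ → x ∈ s) :
    ENNReal.ofReal (1 - δ) ≤ p.toOuterMeasure s := by
  have h1 : (1 : ℝ≥0∞) ≤ p.toOuterMeasure s + ENNReal.ofReal δ := by
    calc (1 : ℝ≥0∞) = p.toOuterMeasure p.support :=
          ((PMF.toOuterMeasure_apply_eq_one_iff p p.support).2 le_rfl).symm
      _ ≤ p.toOuterMeasure (s ∪ (b₁ ∪ b₂ ∪ b₃)) := by
          refine MeasureTheory.measure_mono fun x hx => ?_
          by_contra hc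
          simp only [Set.mem_union, not_or] at hc
          exact hc.1 (hs x hx hc.2.1.1 hc.2.1.2 hc.2.2)
      _ ≤ p.toOuterMeasure s + (p.toOuterMeasure b₁ + p.toOuterMeasure b₂
            + p.toOuterMeasure b₃) :=
          (MeasureTheory.measure_union_le _ _).trans (add_le_add_right
            ((MeasureTheory.measure_union_le _ _).trans (add_le_add_left
              (MeasureTheory.measure_union_le _ _) _)) _)
      _ ≤ p.toOuterMeasure s + ENNReal.ofReal δ := by
          refine add_le_add_right ((add_le_add (add_le_add h₁ h₂) h₃).trans ?_) _
          rw [← ENNReal.ofReal_add n₁ n₂, ← ENNReal.ofReal_add (add_nonneg n₁ n₂) n₃]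
          exact ENNReal.ofReal_le_ofReal hδ
  rw [ENNReal.ofReal_sub _ (by linarith), ENNReal.ofReal_one]
  exact tsub_le_iff_right.2 h1

theorem exists_seq_forall_take_eq {E : Type*} {l : List E} (hl : l ≠ []) :
    ∃ e : ℕ → E, (∀ k ≤ l.length, l.take k = (List.range k).map e) ∧ ∀ t < l.length, e t ∈ l := by
  -- The padding beyond the end of the list is never looked at.
  refine ⟨fun t => l.getD t (l.head hl), fun k hk => ?_, fun t ht => ?_⟩
  · refine List.ext_getElem (by simpa using hk) fun n h1 h2 => ?_
    have hn : n < l.length := by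
      simp only [List.length_take, lt_min_iff] at h1
      exact h1.2
    simp [hn]
  · simp [ht]

section Numerics

variable {K H S A : ℕ} {δ : ℝ}

theorem exp_neg_logFactor (hK : 1 ≤ K) (hH : 1 ≤ H) (hS : 1 ≤ S) (hA : 1 ≤ A) (h0 : 0 < δ) :
    Real.exp (-logFactor K H S A δ) = δ / ((K : ℝ) * H * S * A) := by
  have h1 : (0 : ℝ) < K := by exact_mod_cast hK
  have h2 : (0 : ℝ) < H := by exact_mod_cast hH
  have h3 : (0 : ℝ) < S := by exact_mod_cast hS
  have h4 : (0 : ℝ) < A := by exact_mod_cast hA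
  rw [logFactor, Real.exp_neg, Real.exp_log (by positivity), inv_div]

theorem two_le_natCast_mul (hH : 1 ≤ H) (hS : 1 ≤ S) (hA : 2 ≤ A) :
    (2 : ℝ) ≤ (H : ℝ) * S * A := by
  have : 1 * 1 * 2 ≤ H * S * A := Nat.mul_le_mul (Nat.mul_le_mul hH hS) hA
  exact_mod_cast this

theorem log_two_mul_le_logFactor (hK : 1 ≤ K) (hH : 1 ≤ H) (hS : 1 ≤ S) (hA : 2 ≤ A) (h0 : 0 < δ)
    (h1 : δ < 1) : Real.log 2 + Real.log K ≤ logFactor K H S A δ := by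
  have hK0 : (0 : ℝ) < K := by exact_mod_cast hK
  have hprod := two_le_natCast_mul hH hS hA
  rw [← Real.log_mul (by norm_num) hK0.ne', logFactor]
  refine Real.log_le_log (by positivity) ?_
  rw [le_div_iff₀ h0]
  calc 2 * (K : ℝ) * δ ≤ 2 * K * 1 := mul_le_mul_of_nonneg_left h1.le (by positivity)
    _ = K * 2 := by ring
    _ ≤ K * (H * S * A) := mul_le_mul_of_nonneg_left hprod hK0.le
    _ = _ := by ring

/-- Everything is a power of `q = exp (-ι) = δ / (K H S A)`. For the transitions, `q ^ S` cancels
the number `2 ^ S` of events and `q ^ 3` pays for the other indices. Two noises and the transitions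
together stay below `δ`. -/
theorem failure_probability_le (hK : 1 ≤ K) (hH : 1 ≤ H) (hS : 1 ≤ S) (hA : 2 ≤ A) (h0 : 0 < δ)
    (h1 : δ < 1) :
    (K : ℝ) * Real.exp (-(4 * logFactor K H S A δ)) ≤ δ / 8 ∧
    (K : ℝ) * K * H * S * A * 2 ^ S * Real.exp (-(4 * S * logFactor K H S A δ)) ≤ δ / 2 := by
  have hK1 : (1 : ℝ) ≤ K := by exact_mod_cast hK
  have hprod := two_le_natCast_mul hH hS hA
  set M : ℝ := (H : ℝ) * S * A with hM
  set q := Real.exp (-logFactor K H S A δ) with hq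
  have hqe : q = δ / (K * M) := by
    rw [hq, exp_neg_logFactor hK hH hS (by omega) h0, hM]
    ring
  have hq0 : 0 < q := Real.exp_pos _
  have hKMq : K * M * q = δ := by
    rw [hqe]
    field_simp
  have hKq : K * q ≤ δ := by
    have : 0 < K * q := by positivity
    nlinarith
  have hqh : q ≤ 1 / 2 := by
    have : M * q ≤ K * M * q := by nlinarith [mul_pos (show 0 < M by linarith) hq0]
    nlinarith
  constructor
  · have e : Real.exp (-(4 * logFactor K H S A δ)) = q ^ 4 := by
      rw [hq, ← Real.exp_nat_mul]
      congr 1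
      push_cast
      ring
    rw [e]
    have h3 : q ^ 3 ≤ (1 / 2) ^ 3 := pow_le_pow_left₀ hq0.le hqh 3
    calc (K : ℝ) * q ^ 4 = (K * q) * q ^ 3 := by ring
      _ ≤ δ * (1 / 2) ^ 3 := mul_le_mul hKq h3 (by positivity) h0.le
      _ = δ / 8 := by ring
  · have e : Real.exp (-(4 * S * logFactor K H S A δ)) = q ^ S * q ^ (3 * S) := by
      rw [← pow_add, hq, ← Real.exp_nat_mul]
      congr 1
      push_cast
      ring
    have h2 : (2 : ℝ) ^ S * q ^ S ≤ 1 := by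
      rw [← mul_pow]
      exact pow_le_one₀ (by positivity) (by linarith)
    have h3 : q ^ (3 * S) ≤ q ^ 3 :=
      pow_le_pow_of_le_one hq0.le (by linarith) (by omega)
    rw [e]
    calc (K : ℝ) * K * H * S * A * 2 ^ S * (q ^ S * q ^ (3 * S))
        = (K * K * M) * ((2 ^ S * q ^ S) * q ^ (3 * S)) := by rw [hM]; ring
      _ ≤ (K * K * M) * (1 * q ^ 3) := by gcongr
      _ = (K * M * q) * (K * q) * q := by ring
      _ = δ * (K * q) * q := by rw [hKMq]
      _ ≤ δ * 1 * (1 / 2) := by gcongr; linarith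
      _ = δ / 2 := by ring

/-- The length is at most `1 + log₂ K`, and `log 2 > 1 / 2` gives the factor 2. -/
theorem natCast_size_le {ι : ℝ} {k : ℕ} (hkK : k ≤ K)
    (hι : Real.log 2 + Real.log K ≤ ι) :
    (k.size : ℝ) ≤ 2 * ι := by
  have hl2 := Real.log_two_gt_d9
  have hlK : 0 ≤ Real.log K := Real.log_natCast_nonneg K
  have h1 : (k.size : ℝ) ≤ K.size := by exact_mod_cast Nat.size_le_size hkK
  rcases hs : K.size with _ | n
  · rw [hs] at h1
    push_cast at h1
    linarith
  · have h2 : 2 ^ n ≤ K := Nat.lt_size.1 (by omega)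
    have h3 : ((2 : ℝ) ^ n) ≤ K := by exact_mod_cast h2
    have h4 := Real.log_le_log (by positivity) h3
    rw [Real.log_pow] at h4
    rw [hs] at h1
    push_cast at h1
    have hn : (0 : ℝ) ≤ n := Nat.cast_nonneg n
    nlinarith

/-- With `ε = 1 / K` the grid has denominator exactly `m * K`, and `m * K + 1 ≤ 2 * K ^ 2`. -/
theorem log_card_cover_le {ι : ℝ} {m P : ℕ} (hm : m ≤ K) (hmP : m ≤ P) (hK : 1 ≤ K)
    (hι : Real.log 2 + Real.log K ≤ ι) :
    Real.log ((⌈(m : ℝ) / (1 / K)⌉₊ + 1 : ℕ) ^ m : ℕ) ≤ P * (3 * ι) := by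
  have hl2 := Real.log_two_gt_d9
  have hlK : 0 ≤ Real.log K := Real.log_natCast_nonneg K
  have hK0 : (0 : ℝ) < K := by exact_mod_cast hK
  have e : ⌈(m : ℝ) / (1 / K)⌉₊ = m * K := by
    rw [div_div_eq_mul_div, div_one, ← Nat.cast_mul, Nat.ceil_natCast]
  rw [e]
  push_cast
  rw [Real.log_pow]
  have h1 : ((m : ℝ) * K + 1) ≤ 2 * (K * K) := by
    have h2 : m * K + 1 ≤ 2 * (K * K) := by nlinarith
    exact_mod_cast h2
  have h2 := Real.log_le_log (by positivity) h1
  rw [Real.log_mul (by norm_num) (by positivity), Real.log_mul hK0.ne' hK0.ne'] at h2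
  have h3 : Real.log ((m : ℝ) * K + 1) ≤ 3 * ι := by linarith
  exact mul_le_mul (by exact_mod_cast hmP) h3
    (Real.log_nonneg (by linarith [show 0 ≤ (m : ℝ) * K by positivity])) (Nat.cast_nonneg _)

end Numerics

theorem sqrt_le_mul_sqrt {m y z : ℝ} (hm : 0 ≤ m) (h : y ≤ m ^ 2 * z) :
    Real.sqrt y ≤ m * Real.sqrt z := by
  calc Real.sqrt y ≤ Real.sqrt (m ^ 2 * z) := Real.sqrt_le_sqrt h
    _ = m * Real.sqrt z := by rw [Real.sqrt_mul (sq_nonneg m), Real.sqrt_sq hm]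

/-- Simplification of the regret bound. -/
theorem regret_bound_simplify {c x S A k ι P T ε b R : ℝ} (hc : 0 ≤ c) (hx : 1 ≤ x) (hS : 1 ≤ S)
    (hA : 2 ≤ A) (hk : 1 ≤ k) (hι : 1 / 2 ≤ ι) (hP : 1 ≤ P) (hT0 : 0 ≤ T)
    (hT : T ≤ P + x * S * A * (2 * ι)) (hb : b = c * x * Real.sqrt (S * ι)) (hε : ε * k ≤ 1)
    (htriv : R ≤ x * k)
    (hR : R ≤ 3 * x * Real.sqrt (P * (3 * ι)) * Real.sqrt ((T + 1) * k) + 4 * x * ε * k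
      + x * Real.sqrt (2 * k * (4 * ι)) + 2 * b * x * Real.sqrt (2 * k * (4 * ι))
      + 8 * b * x * Real.sqrt (S * A * k) + 2 * x * T) :
    R ≤ 30 * (1 + c) * (Real.sqrt (x ^ 4 * S ^ 2 * A * k * ι ^ 2)
      + Real.sqrt (P * S * A * x ^ 3 * k * ι ^ 2) + Real.sqrt (P ^ 2 * x ^ 2 * k * ι)) := by
  have hι0 : 0 < ι := by linarith
  have hx0 : 0 < x := by linarith
  have hS0 : 0 < S := by linarith
  have hA0 : 0 < A := by linarith
  have hk0 : 0 < k := by linarith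
  have hP0 : 0 < P := by linarith
  set R1 := Real.sqrt (x ^ 4 * S ^ 2 * A * k * ι ^ 2) with hR1
  set R2 := Real.sqrt (P * S * A * x ^ 3 * k * ι ^ 2) with hR2
  set R3 := Real.sqrt (P ^ 2 * x ^ 2 * k * ι) with hR3
  have hR2sq : R2 ^ 2 = P * S * A * x ^ 3 * k * ι ^ 2 := Real.sq_sqrt (by positivity)
  have hR3sq : R3 ^ 2 = P ^ 2 * x ^ 2 * k * ι := Real.sq_sqrt (by positivity)
  have hR1n : 0 ≤ R1 := Real.sqrt_nonneg _
  have hR2n : 0 ≤ R2 := Real.sqrt_nonneg _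
  have hR3n : 0 ≤ R3 := Real.sqrt_nonneg _
  have e1 : R1 = x ^ 2 * (S * ι) * Real.sqrt (A * k) := by
    rw [hR1, show x ^ 4 * S ^ 2 * A * k * ι ^ 2 = (x ^ 2 * (S * ι)) ^ 2 * (A * k) by ring,
      Real.sqrt_mul (sq_nonneg _), Real.sqrt_sq (by positivity)]
  have e3 : R3 = P * x * Real.sqrt (k * ι) := by
    rw [hR3, show P ^ 2 * x ^ 2 * k * ι = (P * x) ^ 2 * (k * ι) by ring,
      Real.sqrt_mul (sq_nonneg _), Real.sqrt_sq (by positivity)]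
  have hak : 1 ≤ Real.sqrt (A * k) :=
    Real.one_le_sqrt.2 (one_le_mul_of_one_le_of_one_le (by linarith) hk)
  have hkι : 1 / 2 ≤ k * ι := hι.trans (le_mul_of_one_le_left hι0.le hk)
  have hki : 1 / 2 ≤ Real.sqrt (k * ι) := Real.le_sqrt_of_sq_le (by linarith)
  have hxx : x ≤ x ^ 2 := le_self_pow₀ hx two_ne_zero
  have hSι : 1 / 2 ≤ S * ι := hι.trans (le_mul_of_one_le_left hι0.le hS)
  have hR1x : x * Real.sqrt (A * k) ≤ 2 * R1 := by
    rw [e1]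
    have h1 : x * 1 ≤ x ^ 2 * (2 * (S * ι)) :=
      mul_le_mul hxx (by linarith) zero_le_one (sq_nonneg x)
    have h2 := mul_le_mul_of_nonneg_right h1 (Real.sqrt_nonneg (A * k))
    linarith
  have hxR1 : x ≤ 2 * R1 := (le_mul_of_one_le_right hx0.le hak).trans hR1x
  have hPR3 : P * x ≤ 2 * R3 := by
    rw [e3]
    have h1 := mul_le_mul_of_nonneg_left hki (mul_pos hP0 hx0).le
    linarith
  -- The EXP3 term: the part `P` of `T` produces `R3`, the part `x * S * A * ι` produces `R2`; the
  -- extra 1 goes into `P ≥ 1`.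
  have ta : 3 * x * Real.sqrt (P * (3 * ι)) * Real.sqrt ((T + 1) * k) ≤ 8 * (R2 + R3) := by
    have hT1 : T + 1 ≤ 2 * P + 2 * (x * S * A * ι) := by linarith
    rw [mul_assoc, ← Real.sqrt_mul (by positivity)]
    have h : P * (3 * ι) * ((T + 1) * k) * (9 * x ^ 2) ≤ (8 * (R2 + R3)) ^ 2 := by
      have h1 := mul_le_mul_of_nonneg_left hT1
        (show 0 ≤ 27 * P * ι * k * x ^ 2 by positivity)
      have h2 : 0 ≤ R2 * R3 := mul_nonneg hR2n hR3n
      have h3 : 27 * P * ι * k * x ^ 2 * (2 * P + 2 * (x * S * A * ι)) =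
          54 * R3 ^ 2 + 54 * R2 ^ 2 := by
        rw [hR2sq, hR3sq]
        ring
      have h4 : (8 * (R2 + R3)) ^ 2 = 64 * R2 ^ 2 + 128 * (R2 * R3) + 64 * R3 ^ 2 := by ring
      linarith [sq_nonneg R2, sq_nonneg R3]
    have h' := Real.sqrt_le_sqrt h
    rw [Real.sqrt_sq (by positivity), Real.sqrt_mul (by positivity),
      show 9 * x ^ 2 = (3 * x) ^ 2 by ring, Real.sqrt_sq (by positivity)] at h'
    linarith
  have tb : 4 * x * ε * k ≤ 8 * R1 := by
    have h1 := mul_le_mul_of_nonneg_left hε (show 0 ≤ 4 * x by positivity)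
    linarith
  have h8 : Real.sqrt (2 * k * (4 * ι)) ≤ 3 * Real.sqrt (k * ι) :=
    sqrt_le_mul_sqrt (by norm_num) (by linarith)
  have tc : x * Real.sqrt (2 * k * (4 * ι)) ≤ 3 * R3 := by
    rw [e3]
    have h1 := mul_le_mul_of_nonneg_left h8 hx0.le
    have h2 : 1 * (x * Real.sqrt (k * ι)) ≤ P * (x * Real.sqrt (k * ι)) :=
      mul_le_mul_of_nonneg_right hP (by positivity)
    linarith
  have hkA : 8 * (S * (k * ι ^ 2)) ≤ (3 * (S * ι)) ^ 2 * (A * k) := by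
    have h1 : 1 ≤ S * A := one_le_mul_of_one_le_of_one_le hS (by linarith)
    have h2 := mul_le_mul_of_nonneg_left h1 (show 0 ≤ 9 * (S * (k * ι ^ 2)) by positivity)
    have h3 : 0 ≤ S * (k * ι ^ 2) := by positivity
    linarith
  have td : 2 * b * x * Real.sqrt (2 * k * (4 * ι)) ≤ 6 * c * R1 := by
    have h1 : Real.sqrt (S * ι) * Real.sqrt (2 * k * (4 * ι))
        ≤ 3 * (S * ι) * Real.sqrt (A * k) := by
      rw [← Real.sqrt_mul (by positivity)]
      refine sqrt_le_mul_sqrt (by positivity) (le_trans (le_of_eq ?_) hkA)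
      ring
    have h2 := mul_le_mul_of_nonneg_left h1 (show 0 ≤ 2 * c * x ^ 2 by positivity)
    rw [e1, hb]
    linarith
  have te : 8 * b * x * Real.sqrt (S * A * k) ≤ 16 * c * R1 := by
    have h1 : Real.sqrt (S * ι) * Real.sqrt (S * A * k)
        ≤ 2 * (S * ι) * Real.sqrt (A * k) := by
      rw [← Real.sqrt_mul (by positivity)]
      refine sqrt_le_mul_sqrt (by positivity) ?_
      have h2 : ι ≤ 4 * ι ^ 2 := by linarith [mul_le_mul_of_nonneg_left hι hι0.le]
      have h3 := mul_le_mul_of_nonneg_left h2 (show 0 ≤ S ^ 2 * A * k by positivity)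
      linarith
    have h2 := mul_le_mul_of_nonneg_left h1 (show 0 ≤ 8 * c * x ^ 2 by positivity)
    rw [e1, hb]
    linarith
  have hcR1 : 0 ≤ c * R1 := mul_nonneg hc hR1n
  have hcR2 : 0 ≤ c * R2 := mul_nonneg hc hR2n
  have hcR3 : 0 ≤ c * R3 := mul_nonneg hc hR3n
  -- The restart cost contains `x ^ 2 * S * A * ι` without any `k`, which `R1` dominates only if `A
  -- ≤ √(A k)`. Otherwise the trivial bound satisfies `x * k ≤ x * √(A k) ≤ 2 * R1`.
  rcases le_total A k with hAk | hAk
  · have hAs : A ≤ Real.sqrt (A * k) := Real.le_sqrt_of_sq_le (by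
      rw [sq]
      exact mul_le_mul_of_nonneg_left hAk hA0.le)
    have tf : 2 * x * T ≤ 4 * R3 + 4 * R1 := by
      have h1 := mul_le_mul_of_nonneg_left hT (show 0 ≤ 2 * x by positivity)
      have h2 := mul_le_mul_of_nonneg_left hAs (show 0 ≤ x ^ 2 * (S * ι) by positivity)
      rw [← e1] at h2
      linarith
    linarith
  · have hks : k ≤ Real.sqrt (A * k) := Real.le_sqrt_of_sq_le (by
      rw [sq]
      exact mul_le_mul_of_nonneg_right hAk hk0.le)
    have h1 := mul_le_mul_of_nonneg_left hks hx0.le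
    linarith

/-! ### Degenerate cases, accuracy of the bonus, and the main theorem. -/

theorem regret_le_horizon_mul {S A B : Type*} {H : ℕ} [Fintype S] [Fintype A] [Fintype B]
    [Nonempty A] (G : MarkovGame S A B H) (e : ℕ → Episode S A B H) (k : ℕ) :
    G.regret ((List.range k).map e) ≤ H * k := by
  have : Nonempty (MaxPolicy S A B H) := ⟨(e 0).pol⟩
  refine ciSup_le fun μ => ?_
  rw [List.map_map, sum_map_range]
  calc _ ≤ ∑ _t ∈ Finset.range k, (H : ℝ) := Finset.sum_le_sum fun t _ => by
        have h1 := (value_mem_Icc G μ (e t).opp).2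
        have h2 := (value_mem_Icc G (e t).pol (e t).opp).1
        rw [Function.comp_apply]
        linarith
    _ = _ := by rw [Finset.sum_const, Finset.card_range, nsmul_eq_mul, mul_comm]

theorem regret_eq_zero_of_subsingleton {S A B : Type*} {H : ℕ} [Fintype S] [Fintype A] [Fintype B]
    [Nonempty A] [Subsingleton A] (G : MarkovGame S A B H) (l : List (Episode S A B H)) :
    G.regret l = 0 := by
  have : Subsingleton (PMF A) := ⟨fun p q => by
    ext a
    have hp := p.tsum_coe
    have hq := q.tsum_coe
    rw [tsum_fintype, Fintype.sum_subsingleton _ a] at hp hq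
    rw [hp, hq]⟩
  have hpol : ∀ μ μ' : MaxPolicy S A B H, μ = μ' := fun μ μ' => by
    funext h τ s
    exact Subsingleton.elim _ _
  have h0 : ∀ μ : MaxPolicy S A B H,
      (l.map fun e => G.value μ e.opp - G.value e.pol e.opp).sum = 0 := fun μ => by
    refine List.sum_eq_zero fun x hx => ?_
    obtain ⟨e, -, rfl⟩ := List.mem_map.1 hx
    rw [hpol μ e.pol, sub_self]
  simp [MarkovGame.regret, h0]

theorem bonus_eq (c : ℝ) (H S : ℕ) {ι : ℝ} (hι : 0 ≤ ι) (n : ℕ) :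
    bonus c H S ι n = c * H * Real.sqrt (S * ι) * (1 / Real.sqrt (max (n : ℝ) 1)) := by
  rw [bonus, Real.sqrt_div (by positivity)]
  ring

/-- Counters for which no event has a large deviation are accurate. -/
theorem accurate_bonus {S A B : Type*} {H : ℕ} [Fintype S] [Fintype A] [Fintype B]
    (G : MarkovGame S A B H) {c ι : ℝ} (hc : 3 ≤ c) (hι : 1 / 2 ≤ ι) {N : Counters S A B H}
    (hN : ∀ h s a, ∀ U : Finset S, N.visits h s a ≠ 0 →
      ∑ s' ∈ U, N.empirical h s a s' - ∑ s' ∈ U, (G.trans h s a s').toReal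
        ≤ Real.sqrt (2 * (4 * Fintype.card S * ι) / N.visits h s a)) :
    G.Accurate (bonus c H (Fintype.card S) ι) N := by
  have hS : (1 : ℝ) ≤ Fintype.card S := by
    have : 0 < Fintype.card S := Fintype.card_pos_iff.2 ⟨G.start⟩
    exact_mod_cast this
  have hH : (0 : ℝ) ≤ H := Nat.cast_nonneg H
  refine accurate_of_forall_event G _ N (d := fun h s a => if N.visits h s a = 0 then 1 else
    Real.sqrt (2 * (4 * Fintype.card S * ι) / N.visits h s a)) (fun h s a U => ?_)
    fun h s a => ?_
  · by_cases h0 : N.visits h s a = 0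
    · rw [if_pos h0]
      have h1 : ∑ s' ∈ U, N.empirical h s a s' ≤ 1 :=
        (Finset.sum_le_univ_sum_of_nonneg fun s' => empirical_nonneg N h s a s').trans_eq
          (sum_empirical N h s a)
      have h2 : 0 ≤ ∑ s' ∈ U, (G.trans h s a s').toReal :=
        Finset.sum_nonneg fun _ _ => ENNReal.toReal_nonneg
      linarith
    · rw [if_neg h0]
      exact hN h s a U h0
  · have hSι : 1 / 2 ≤ (Fintype.card S : ℝ) * ι := by nlinarith
    rw [bonus]
    set q := Real.sqrt (Fintype.card S * ι / max (N.visits h s a : ℝ) 1) with hq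
    -- The origin of `c₀ = 3`: at visited pairs `√8 ≤ 3`, and at unvisited ones the trivial error 1
    -- is covered because `S * ι ≥ 1 / 2`.
    have key : (if N.visits h s a = 0 then 1 else
        Real.sqrt (2 * (4 * Fintype.card S * ι) / N.visits h s a)) ≤ 3 * q := by
      split_ifs with h0
      · rw [hq, h0]
        have : 1 / 2 ≤ Real.sqrt (Fintype.card S * ι / max ((0 : ℕ) : ℝ) 1) := by
          refine Real.le_sqrt_of_sq_le ?_
          simp only [Nat.cast_zero, zero_le_one, max_eq_right, div_one]
          linarith
        linarith
      · have h1 : (1 : ℝ) ≤ N.visits h s a := by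
          exact_mod_cast Nat.one_le_iff_ne_zero.2 h0
        refine sqrt_le_mul_sqrt (by norm_num) ?_
        rw [max_eq_left h1, ← mul_div_assoc]
        exact div_le_div_of_nonneg_right (by linarith) (by linarith)
    calc (H : ℝ) * _ ≤ H * (3 * q) := mul_le_mul_of_nonneg_left key hH
      _ = 3 * (H * q) := by ring
      _ ≤ c * (H * q) := mul_le_mul_of_nonneg_right hc (mul_nonneg hH (Real.sqrt_nonneg _))
      _ = _ := by ring

theorem mainTheorem2 :
    ∃ c₀ : ℝ, 0 < c₀ ∧ ∀ c : ℝ, c₀ ≤ c → ∃ C : ℝ, 0 < C ∧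
      ∀ (𝒮 𝒜 ℬ : Type*) [Fintype 𝒮] [Fintype 𝒜] [Fintype ℬ] [Nonempty 𝒜] [Nonempty ℬ]
        (H K : ℕ) (δ : ℝ), 1 ≤ H → 1 ≤ K → 0 < δ → δ < 1 →
      ∀ (S A : ℕ), S = Fintype.card 𝒮 → A = Fintype.card (𝒜 × ℬ) →
      ∀ (ι : ℝ), ι = logFactor K H S A δ →
      ∀ (G : MarkovGame 𝒮 𝒜 ℬ H) (Ψ : Finset (MinPolicy 𝒮 𝒜 ℬ H))
        (opp : List (Episode 𝒮 𝒜 ℬ H) → PMF (MinPolicy 𝒮 𝒜 ℬ H)),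
        (∀ l, (opp l).support ⊆ ↑Ψ) →
        ENNReal.ofReal (1 - δ) ≤
          (G.runLaw (bonus c H S ι) (1 / K) opp K).toOuterMeasure
            {l | ∀ k : ℕ, 1 ≤ k → k ≤ K →
              G.regret (l.take k) ≤
                C * (Real.sqrt ((H : ℝ) ^ 4 * S ^ 2 * A * k * ι ^ 2)
                  + Real.sqrt ((Ψ.card : ℝ) * S * A * (H : ℝ) ^ 3 * k * ι ^ 2)
                  + Real.sqrt ((Ψ.card : ℝ) ^ 2 * (H : ℝ) ^ 2 * k * ι))} := by
  refine ⟨3, by norm_num, fun c hc => ⟨30 * (1 + c), by linarith, ?_⟩⟩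
  intro 𝒮 𝒜 ℬ _ _ _ _ _ H K δ hH hK hδ0 hδ1 S A hS hA ι hι G Ψ opp hΨ
  have hc0 : 0 ≤ c := by linarith
  have hS1 : 1 ≤ S := by
    rw [hS]
    exact Fintype.card_pos_iff.2 ⟨G.start⟩
  have hA1 : 1 ≤ A := by
    rw [hA]
    exact Fintype.card_pos
  rcases Nat.lt_or_ge A 2 with hA2 | hA2
  -- If `A = 1`, then `ι` can be arbitrarily close to 0, but the learner has only one policy and no
  -- regret. From here on `A ≥ 2` makes `ι ≥ 1 / 2`.
  · have hcard : Fintype.card 𝒜 ≤ 1 := by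
      rw [hA, Fintype.card_prod] at hA2
      have : 0 < Fintype.card ℬ := Fintype.card_pos
      nlinarith
    have : Subsingleton 𝒜 := Fintype.card_le_one_iff_subsingleton.1 hcard
    refine ofReal_one_sub_le_toOuterMeasure (b₁ := ∅) (b₂ := ∅) (b₃ := ∅) (δ₁ := 0) (δ₂ := 0)
      (δ₃ := 0) _ (by simp) (by simp) (by simp) le_rfl le_rfl le_rfl (by linarith)
      fun l _ _ _ _ => ?_
    rw [Set.mem_ofPred_eq]
    intro k _ _
    rw [regret_eq_zero_of_subsingleton]
    exact mul_nonneg (by linarith) (by positivity)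
  have hlog : Real.log 2 + Real.log K ≤ ι := by
    rw [hι]
    exact log_two_mul_le_logFactor hK hH hS1 hA2 hδ0 hδ1
  have hι2 : 1 / 2 ≤ ι := by
    have h1 := Real.log_two_gt_d9
    have h2 := Real.log_natCast_nonneg K
    linarith
  have hι0 : 0 < ι := by linarith
  have hH0 : (0 : ℝ) < H := by exact_mod_cast hH
  have hK0 : (0 : ℝ) < K := by exact_mod_cast hK
  have hS0 : (0 : ℝ) < S := by exact_mod_cast hS1
  set β := bonus c H S ι with hβdef
  set b := c * H * Real.sqrt (S * ι) with hb
  have hb0 : 0 < b := by positivity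
  have hβ : ∀ n, β n = b * (1 / Real.sqrt (max (n : ℝ) 1)) := bonus_eq c H S hι0.le
  have hβ0 : ∀ n, β n ∈ Set.Icc 0 b := fun n => by
    rw [hβ]
    refine ⟨by positivity, mul_le_of_le_one_right hb0.le ?_⟩
    rw [div_le_one (Real.sqrt_pos.2 (lt_of_lt_of_le one_pos (le_max_right _ _)))]
    exact Real.one_le_sqrt.2 (le_max_right _ _)
  obtain ⟨hf1, hf2⟩ := failure_probability_le hK hH hS1 hA2 hδ0 hδ1
  rw [← hι] at hf1 hf2
  -- The level `4 * S * ι` has the factor `S` to beat the `2 ^ S` events; the noises need only `4 *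
  -- ι`.
  have hbad1 := runLaw_exists_event_deviation_le G β (1 / K) opp K
    (L := 4 * S * ι) (by positivity)
  have hbad2 := runLaw_exists_noise_le G (1 / K) opp hH0
    (pmfMean_exp_policyNoise_le G (1 / K) opp (fun n => (hβ0 n).1) hH) K
    (L := 4 * ι) (by positivity)
  have hbad3 := runLaw_exists_noise_le G (1 / K) opp (B' := 2 * b * H) (by positivity)
    (pmfMean_exp_bonusNoise_le G (1 / K) opp hβ0 hb0 hH) K (L := 4 * ι) (by positivity)
  rw [← hS, ← hA] at hbad1
  refine ofReal_one_sub_le_toOuterMeasure _ hbad1 hbad2 hbad3 (by positivity) (by positivity)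
    (by positivity) (by linarith) fun l hl hl1 hl2 hl3 => ?_
  have hlen := length_of_mem_support_runLaw G β (1 / K) opp hl
  have hopp := opp_mem_of_mem_support_runLaw G β (1 / K) opp hΨ hl
  have hne : l ≠ [] := by
    rintro rfl
    simp at hlen
    omega
  obtain ⟨e, he, hmem⟩ := exists_seq_forall_take_eq hne
  rw [hlen] at he hmem
  simp only [Set.mem_ofPred_eq, not_and, not_exists, not_lt, not_le] at hl1 hl2 hl3 ⊢
  intro k hk1 hkK
  have hoppe : ∀ t < k, (e t).opp ∈ Ψ := fun t ht => hopp _ (hmem t (by omega))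
  have hacc : ∀ t ≤ k, G.Accurate β (episodeCount ((List.range t).map e)) := fun t ht => by
    rw [hβdef, hS]
    refine accurate_bonus G hc hι2 fun h s a U h0 => ?_
    rw [← he t (by omega)] at h0 ⊢
    rw [← hS]
    exact hl1 hlen t (by omega) h s a U h0
  have hΛ : ∀ t ≤ k, Real.log (stateAfter G.start G.reward β (1 / K) e t).polSet.card
      ≤ (Ψ.card : ℝ) * (3 * ι) := fun t ht => by
    rw [polSet_stateAfter]
    refine le_trans ?_ (log_card_cover_le
      (m := (stateAfter G.start G.reward β (1 / K) e t).oppSet.card)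
      ((card_oppSet_stateAfter_le _ _ _ _ _ _).trans (by omega))
      (Finset.card_le_card (oppSet_stateAfter_subset _ _ _ _ _ fun i hi =>
        hoppe i (by omega))) hK hlog)
    refine Real.log_le_log ?_ ?_
    · exact_mod_cast Finset.card_pos.2 (ucbBestResponse_nonempty _ _ _ _ _ _)
    · exact_mod_cast card_ucbBestResponse_le _ _ _ _ _ _
  have hreg := regret_le_of_accurate (e := e) hb0.le hβ (ε := 1 / K) (by positivity) hH hΛ hacc
  have hn1 := hl2 hlen k hk1 hkK
  have hn2 := hl3 hlen k hk1 hkK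
  rw [he k hkK] at hn1 hn2 ⊢
  rw [← hS, ← hA] at hreg
  have hT := restartCount_le G.start G.reward β (1 / K) e hoppe
  have hsize := natCast_size_le hkK hlog
  have hTR : (restartCount G.start G.reward β (1 / K) e k : ℝ) ≤
      Ψ.card + H * S * A * (2 * ι) := by
    rw [← hS, ← hA] at hT
    have h1 : (restartCount G.start G.reward β (1 / K) e k : ℝ) ≤
      Ψ.card + H * S * A * k.size := by exact_mod_cast hT
    have h2 := mul_le_mul_of_nonneg_left hsize (show (0 : ℝ) ≤ H * S * A by positivity)
    linarith
  -- `Ψ` is nonempty since it contains the opponent's policy of the first episode.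
  have hP : (1 : ℝ) ≤ Ψ.card := by
    have : 0 < Ψ.card := Finset.card_pos.2 ⟨_, hoppe 0 hk1⟩
    exact_mod_cast this
  refine regret_bound_simplify (T := restartCount G.start G.reward β (1 / K) e k) (ε := 1 / K)
    hc0 (by exact_mod_cast hH) (by exact_mod_cast hS1) (by exact_mod_cast hA2)
    (by exact_mod_cast hk1) hι2 hP (Nat.cast_nonneg _) hTR hb ?_ (regret_le_horizon_mul G e k)
    (by linarith)
  rw [one_div_mul_eq_div, div_le_one hK0]
  exact_mod_cast hkK
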